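/- For a tuple of positive integers $\boldsymbol{k}=(k_1,\dots,k_r)$ with $r\ge 1$ and $k_r\ge 2$ (an admissible index) the series $\zeta(\boldsymbol{k})=\sum_{0<n_1<\cdots<n_r}\frac{1}{n_1^{k_1}\cdots n_r^{k_r}}$ converges. Put $\mathrm{wt}(\boldsymbol{k})=k_1+\cdots+k_r$. Let $\{1\}^m$ be the string $1,\dots,1$ of length $m$. Let $\mathcal{H}=\mathbb{Q}\langle x,y\rangle$, $\mathcal{H}^0=\mathbb{Q}+y\mathcal{H}x$, $\mathcal{H}^{\ge 2}=\mathbb{Q}+yx\,\mathbb{Q}\langle x,yx\rangle\subset\mathcal{H}^0$, and $e_k=yx^{k-1}$ for $k\ge 1$. Let $Z\colon\mathcal{H}^0\to\mathbb{R}$ be the $\mathbb{Q}$-linear map with $Z(1)=1$ and $Z(e_{k_1}\cdots e_{k_r})=\zeta(k_1,\dots,k_r)$ for every admissible index. For a tuple $\boldsymbol{c}=(c_1,\dots,c_{2s})$ of positive integers let $[2s]=\{1,\dots,2s\}$, $[2s]^1_{\boldsymbol{c}}=\{i\in[2s]\mid c_i=1\}$ and $[2s]^{>1}_{\boldsymbol{c}}=\{i\in[2s]\mid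 c_i>1\}$. A set $A\subset[2s]$ is *even-odd* if every even $i\in A$ has $i+1\in A$ and every odd $i\in A$ has $i-1\in A$; it is *odd-even* if every odd $i\in A$ has $i+1\in A$ and every even $i\in A$ has $i-1\in A$. For disjoint $A,B\subset[2s]$ let $\boldsymbol{c}_{(-A)}-\boldsymbol{\delta}_B$ be the tuple obtained from $\boldsymbol{c}$ by lowering the entries at the positions in $B$ by $1$ and deleting the entries at the positions in $A$. Let $\mathcal{D}\colon\mathcal{H}^0\to\mathcal{H}^{\ge 2}$ be the linear map given on words by $\mathcal{D}(y^{c_1}x^{c_2}\cdots y^{c_{2s-1}}x^{c_{2s}})=\mathfrak{D}(\boldsymbol{c})$, where $\mathfrak{D}(\varnothing)=\mathcal{D}(1)=1$ and, recursively for $s\ge 1$, \begin{align*} \mathfrak{D}(\boldsymbol{c})&=\sum_{\substack{A\subset[2s]^1_{\boldsymbol{c}}\\ A:\text{ even-odd}}}\ \sum_{\substack{B\subset[2s]^{>1}_{\boldsymbol{c}}\\ \#A+\#B\ge 1\\ \{2r,2r+1\}\not\subset B\ (1\le r\le s-1)}}(-1)^{\#B-1}\,\mathfrak{D}(\boldsymbol{c}_{(-A)}-\boldsymbol{\delta}_B)\,x^{\#A+\#B}\\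 &\quad+\sum_{\substack{A\subset[2s]^1_{\boldsymbol{c}}\\ A:\text{ even-odd}}}\ \sum_{\substack{B\subset[2s]^{>1}_{\boldsymbol{c}}\\ \#A+\#B\ge 2\\ \{2r,2r+1\}\not\subset B\ (1\le r\le s-1)}}(-1)^{\#B-1}\,\mathfrak{D}(\boldsymbol{c}_{(-A)}-\boldsymbol{\delta}_B)\,yx^{\#A+\#B-1}\\ &\quad+\sum_{\substack{A\subset[2s]^1_{\boldsymbol{c}}\\ A:\text{ odd-even}}}\ \sum_{\substack{B\subset[2s]^{>1}_{\boldsymbol{c}}\\ \#A+\#B\ge 2\\ \{2r-1,2r\}\not\subset B\ (1\le r\le s)}}(-1)^{\#B}\,\mathfrak{D}(\boldsymbol{c}_{(-A)}-\boldsymbol{\delta}_B)\,yx^{\#A+\#B-1}. \end{align*} Theorem. For all positive integers $s$ and $c_1,\dots,c_{2s}$, \[ \zeta(\{1\}^{c_1-1},c_2+1,\dots,\{1\}^{c_{2s-1}-1},c_{2s}+1)=Z(\mathfrak{D}(c_1,\dots,c_{2s})). \] Consequently $\mathcal{D}$ computes an integral expansion of every multiple zeta value: for every admissible index $\boldsymbol{k}$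 all coefficients of $\mathcal{D}(e_{k_1}\cdots e_{k_r})$ on words are integers, and \[ \zeta(\boldsymbol{k})=\sum_{\boldsymbol{l}}c_{\boldsymbol{k};\boldsymbol{l}}\,\zeta(\boldsymbol{l}), \] where $\boldsymbol{l}=(l_1,\dots,l_m)$ runs over the tuples of integers $l_i\ge 2$ with $\mathrm{wt}(\boldsymbol{l})=\mathrm{wt}(\boldsymbol{k})$ and $c_{\boldsymbol{k};\boldsymbol{l}}\in\mathbb{Z}$ is the coefficient of the word $e_{l_1}\cdots e_{l_m}$ in $\mathcal{D}(e_{k_1}\cdots e_{k_r})$. -/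

import Mathlib

namespace HoffmanMZV

/-! ### Multiple zeta values -/

/-- The summation range `0 < n₁ < ⋯ < n_r`. -/
abbrev MZVRange (r : ℕ) : Type := {n : Fin r → ℕ // StrictMono n ∧ ∀ i, 0 < n i}

/-- The summand `1 / (n₁ ^ k₁ ⋯ n_r ^ k_r)`. -/
noncomputable def mzvTerm (k : List ℕ) (n : MZVRange k.length) : ℝ :=
  ∏ i : Fin k.length, 1 / (n.1 i : ℝ) ^ k.get i

/-- `ζ(k₁, …, k_r) = ∑_{0 < n₁ < ⋯ < n_r} 1 / (n₁ ^ k₁ ⋯ n_r ^ k_r)`; the value at the empty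
tuple is `1`. -/
noncomputable def mzv (k : List ℕ) : ℝ := ∑' n : MZVRange k.length, mzvTerm k n

/-- Admissible indices: non-empty tuples of positive integers whose last entry is at least `2`. -/
def IsAdmissible (k : List ℕ) : Prop :=
  (∀ a ∈ k, 0 < a) ∧ ∃ (t : List ℕ) (a : ℕ), 2 ≤ a ∧ k = t ++ [a]

/-- For `c = (c₁, …, c_{2s})`, the index
`({1}^{c₁-1}, c₂ + 1, …, {1}^{c_{2s-1}-1}, c_{2s} + 1)`. -/
def blockIndex : List ℕ → List ℕ
  | a :: b :: t => List.replicate (a - 1) 1 ++ (b + 1) :: blockIndex t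
  | _ => []

/-! ### The Hoffman algebra -/

/-- The two letters `x` and `y`. -/
inductive Letter : Type
  | x
  | y
  deriving DecidableEq

/-- Words in `x` and `y`. -/
abbrev Word : Type := FreeMonoid Letter

/-- The non-commutative polynomial ring `ℚ⟨x, y⟩`. -/
abbrev H : Type := MonoidAlgebra ℚ Word

/-- A word as an element of `ℚ⟨x, y⟩`. -/
noncomputable def ofWord (w : Word) : H := MonoidAlgebra.of ℚ Word w

/-- The variable `x`. -/
noncomputable def X : H := ofWord (FreeMonoid.of Letter.x)

/-- The variable `y`. -/
noncomputable def Y : H := ofWord (FreeMonoid.of Letter.y)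

/-- `ℋ⁰ = ℚ + y ℚ⟨x, y⟩ x`. -/
noncomputable def H0 : Submodule ℚ H where
  carrier := {a | ∃ (q : ℚ) (h : H), a = algebraMap ℚ H q + Y * h * X}
  zero_mem' := ⟨0, 0, by simp⟩
  add_mem' := by
    rintro _ _ ⟨q, h, rfl⟩ ⟨q', h', rfl⟩
    exact ⟨q + q', h + h', by rw [map_add]; noncomm_ring⟩
  smul_mem' := by
    rintro r _ ⟨q, h, rfl⟩
    refine ⟨r * q, r • h, ?_⟩
    rw [smul_add, map_mul, Algebra.smul_def r (algebraMap ℚ H q), mul_smul_comm, smul_mul_assoc]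

/-- `ℋ^{≥ 2} = ℚ + yx ℚ⟨x, yx⟩`. -/
noncomputable def Hge2 : Submodule ℚ H where
  carrier := {a | ∃ (q : ℚ) (h : H), h ∈ Algebra.adjoin ℚ ({X, Y * X} : Set H) ∧
    a = algebraMap ℚ H q + Y * X * h}
  zero_mem' := ⟨0, 0, zero_mem _, by simp⟩
  add_mem' := by
    rintro _ _ ⟨q, h, hh, rfl⟩ ⟨q', h', hh', rfl⟩
    exact ⟨q + q', h + h', add_mem hh hh', by rw [map_add]; noncomm_ring⟩
  smul_mem' := by
    rintro r _ ⟨q, h, hh, rfl⟩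
    refine ⟨r * q, r • h, Subalgebra.smul_mem _ hh r, ?_⟩
    rw [smul_add, map_mul, Algebra.smul_def r (algebraMap ℚ H q), mul_smul_comm]

theorem Hge2_le_H0 : Hge2 ≤ H0 := by
  rintro _ ⟨q, h, hh, rfl⟩
  obtain ⟨h', hh'⟩ : ∃ h', X * h = h' * X := by
    induction hh using Algebra.adjoin_induction with
    | mem a ha =>
      rcases ha with rfl | rfl
      · exact ⟨X, rfl⟩
      · exact ⟨X * Y, by rw [mul_assoc]⟩
    | algebraMap r => exact ⟨algebraMap ℚ H r, (Algebra.commutes r X).symm⟩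
    | add a b _ _ ha hb =>
      obtain ⟨a', ha⟩ := ha
      obtain ⟨b', hb⟩ := hb
      exact ⟨a' + b', by rw [mul_add, add_mul, ha, hb]⟩
    | mul a b _ _ ha hb =>
      obtain ⟨a', ha⟩ := ha
      obtain ⟨b', hb⟩ := hb
      exact ⟨a' * b', by rw [← mul_assoc, ha, mul_assoc, hb, mul_assoc]⟩
  exact ⟨q, h', by rw [mul_assoc Y X h, hh', mul_assoc]⟩

/-- The word `e_{k₁} ⋯ e_{k_r}`, where `e_k = y x^{k-1}`. -/
def eWord (k : List ℕ) : Word :=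
  (k.map fun a => FreeMonoid.of Letter.y * FreeMonoid.of Letter.x ^ (a - 1)).prod

/-- The word `y^{c₁} x^{c₂} ⋯ y^{c_{2s-1}} x^{c_{2s}}`. -/
def blockWord : List ℕ → Word
  | a :: b :: t => FreeMonoid.of Letter.y ^ a * FreeMonoid.of Letter.x ^ b * blockWord t
  | _ => 1

theorem ofWord_mul (v w : Word) : ofWord (v * w) = ofWord v * ofWord w :=
  map_mul (MonoidAlgebra.of ℚ Word) v w

theorem ofWord_one : ofWord 1 = 1 := map_one (MonoidAlgebra.of ℚ Word)

theorem ofWord_mem_H0 (w : Word) :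
    ofWord (FreeMonoid.of Letter.y * w * FreeMonoid.of Letter.x) ∈ H0 :=
  ⟨0, ofWord w, by rw [ofWord_mul, ofWord_mul, map_zero, zero_add]; rfl⟩

theorem ofWord_eWord_mem {k : List ℕ} (hk : IsAdmissible k) : ofWord (eWord k) ∈ H0 := by
  obtain ⟨-, t, a, ha, rfl⟩ := hk
  obtain ⟨b, rfl⟩ : ∃ b, a = b + 2 := ⟨a - 2, by omega⟩
  cases t with
  | nil =>
    have h : eWord ([] ++ [b + 2]) =
        FreeMonoid.of Letter.y * FreeMonoid.of Letter.x ^ b * FreeMonoid.of Letter.x := by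
      simp [eWord, pow_succ, mul_assoc]
    rw [h]
    exact ofWord_mem_H0 _
  | cons d t =>
    have h : eWord (d :: t ++ [b + 2]) = FreeMonoid.of Letter.y *
        (FreeMonoid.of Letter.x ^ (d - 1) * eWord t * FreeMonoid.of Letter.y *
          FreeMonoid.of Letter.x ^ b) * FreeMonoid.of Letter.x := by
      simp [eWord, pow_succ, mul_assoc]
    rw [h]
    exact ofWord_mem_H0 _

theorem blockWord_eq : ∀ (s : ℕ) (c : List ℕ), c.length = 2 * s → (∀ a ∈ c, 0 < a) →
    c = [] ∨ ∃ w, blockWord c = FreeMonoid.of Letter.y * w * FreeMonoid.of Letter.x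
  | _, [], _, _ => Or.inl rfl
  | _, [_], h, _ => by simp at h; omega
  | s, a :: b :: t, h, hc => by
    right
    obtain ⟨a, rfl⟩ : ∃ a', a = a' + 1 := ⟨a - 1, by have := hc a (by simp); omega⟩
    obtain ⟨b, rfl⟩ : ∃ b', b = b' + 1 := ⟨b - 1, by have := hc b (by simp); omega⟩
    rcases blockWord_eq (s - 1) t (by simp at h; omega)
      (fun d hd => hc d (by simp [hd])) with rfl | ⟨w, hw⟩
    · exact ⟨FreeMonoid.of Letter.y ^ a * FreeMonoid.of Letter.x ^ b, by
        simp only [blockWord, mul_one, pow_succ' _ a, pow_succ _ b, mul_assoc]⟩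
    · exact ⟨FreeMonoid.of Letter.y ^ a * FreeMonoid.of Letter.x ^ (b + 1) *
        FreeMonoid.of Letter.y * w, by
        simp only [blockWord, hw, pow_succ' _ a, mul_assoc]⟩

theorem ofWord_blockWord_mem {s : ℕ} {c : List ℕ} (hlen : c.length = 2 * s)
    (hpos : ∀ a ∈ c, 0 < a) : ofWord (blockWord c) ∈ H0 := by
  rcases blockWord_eq s c hlen hpos with rfl | ⟨w, hw⟩
  · exact ⟨1, 0, by rw [map_one, mul_zero, zero_mul, add_zero]; exact ofWord_one⟩
  · rw [hw]
    exact ofWord_mem_H0 w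

/-- The linear map on `ℚ⟨x, y⟩` with prescribed values on words. -/
noncomputable def wordLift {M : Type} [AddCommMonoid M] [Module ℚ M] (f : Word → M) :
    H →ₗ[ℚ] M :=
  Finsupp.linearCombination ℚ f ∘ₗ (MonoidAlgebra.coeffLinearEquiv ℚ).toLinearMap

theorem wordLift_ofWord {M : Type} [AddCommMonoid M] [Module ℚ M] (f : Word → M) (w : Word) :
    wordLift f (ofWord w) = f w := by
  simp [wordLift, ofWord]

/-! ### The map `Z` -/

/-- The tuple `(k₁, …, k_r)` read off from the word `e_{k₁} ⋯ e_{k_r}` (each `k_i` is one more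
than the number of letters `x` directly after the `i`-th letter `y`). -/
def wordIndex : List Letter → List ℕ
  | [] => []
  | Letter.x :: w => wordIndex w
  | Letter.y :: w => ((w.takeWhile (· = Letter.x)).length + 1) :: wordIndex w

/-- The `ℚ`-linear map `Z : ℋ⁰ → ℝ` with `Z(e_{k₁} ⋯ e_{k_r}) = ζ(k₁, …, k_r)`, `Z(1) = 1`. -/
noncomputable def Z : H0 →ₗ[ℚ] ℝ :=
  (wordLift fun w => mzv (wordIndex w.toList)).domRestrict H0

/-! ### The map `𝒟` -/

/-- The `i`-th entry of `c`, positions being counted from `1`. -/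
def entry (c : List ℕ) (i : ℕ) : ℕ := c.getD (i - 1) 0

/-- The set of positions `[r] = {1, …, r}` of an index of depth `r`. -/
def positions (c : List ℕ) : Finset ℕ := Finset.Icc 1 c.length

/-- The positions `i` with `c_i = 1`. -/
def onePos (c : List ℕ) : Finset ℕ := (positions c).filter fun i => entry c i = 1

/-- The positions `i` with `c_i > 1`. -/
def bigPos (c : List ℕ) : Finset ℕ := (positions c).filter fun i => 1 < entry c i

/-- `A` is even-odd: an even `i ∈ A` has `i + 1 ∈ A`, an odd `i ∈ A` has `i - 1 ∈ A`. -/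
def EvenOdd (A : Finset ℕ) : Prop :=
  ∀ i ∈ A, (Even i → i + 1 ∈ A) ∧ (Odd i → i - 1 ∈ A)

/-- `A` is odd-even: an odd `i ∈ A` has `i + 1 ∈ A`, an even `i ∈ A` has `i - 1 ∈ A`. -/
def OddEven (A : Finset ℕ) : Prop :=
  ∀ i ∈ A, (Odd i → i + 1 ∈ A) ∧ (Even i → i - 1 ∈ A)

/-- `{2r, 2r+1} ⊄ B` for all `r` with `1 ≤ r ≤ s - 1`. -/
def NoEvenOddPair (s : ℕ) (B : Finset ℕ) : Prop :=
  ∀ r ∈ Finset.Icc 1 (s - 1), ¬({2 * r, 2 * r + 1} : Finset ℕ) ⊆ B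

/-- `{2r-1, 2r} ⊄ B` for all `r` with `1 ≤ r ≤ s`. -/
def NoOddEvenPair (s : ℕ) (B : Finset ℕ) : Prop :=
  ∀ r ∈ Finset.Icc 1 s, ¬({2 * r - 1, 2 * r} : Finset ℕ) ⊆ B

/-- The index `c_{(-A)} - δ_B`: subtract one from the entries at the positions in `B` and
delete the entries at the positions in `A`. -/
def reduce (c : List ℕ) (A B : Finset ℕ) : List ℕ :=
  ((List.range' 1 c.length).filter (· ∉ A)).map fun i => entry c i - if i ∈ B then 1 else 0

theorem sum_eq_sum_entry (c : List ℕ) : c.sum = ∑ i ∈ positions c, entry c i := by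
  have h : ∑ i ∈ positions c, entry c i = ∑ j ∈ Finset.range c.length, c.getD j 0 := by
    rw [Finset.range_eq_Ico, positions]
    have := Finset.sum_Ico_add' (entry c) 0 c.length 1
    simp only [entry, add_tsub_cancel_right] at this
    rw [this]
    rfl
  rw [h, Finset.sum_range, ← List.sum_ofFn]
  congr 1
  apply List.ext_get <;> simp

theorem reduce_sum_add {c : List ℕ} {A B : Finset ℕ} (hA : A ⊆ onePos c) (hB : B ⊆ bigPos c) :
    (reduce c A B).sum + (A.card + B.card) = c.sum := by
  have h1 : (reduce c A B).sum =
      ∑ i ∈ (positions c).filter (· ∉ A), (entry c i - if i ∈ B then 1 else 0) := by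
    have hf : (positions c).filter (· ∉ A) =
        ((List.range' 1 c.length).filter (· ∉ A)).toFinset := by
      ext i
      simp [positions, List.mem_range'_1]
      intro _
      omega
    rw [hf, List.sum_toFinset _ (List.Nodup.filter _ List.nodup_range'), reduce]
  have hAp : (positions c).filter (· ∈ A) = A := by
    ext i
    simp only [Finset.mem_filter]
    exact ⟨fun h => h.2, fun h => ⟨(Finset.mem_filter.1 (hA h)).1, h⟩⟩
  have hBp : B ⊆ (positions c).filter (· ∉ A) := by
    intro i hi
    have h := Finset.mem_filter.1 (hB hi)
    refine Finset.mem_filter.2 ⟨h.1, fun hiA => ?_⟩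
    have := (Finset.mem_filter.1 (hA hiA)).2
    have := h.2
    omega
  have hBs : ∑ i ∈ (positions c).filter (· ∉ A), (if i ∈ B then 1 else 0) = B.card := by
    rw [← Finset.sum_filter, Finset.filter_mem_eq_inter, Finset.inter_eq_right.2 hBp]
    simp
  have hAs : ∑ i ∈ A, entry c i = A.card := by
    rw [Finset.card_eq_sum_ones]
    exact Finset.sum_congr rfl fun i hi => (Finset.mem_filter.1 (hA hi)).2
  have hsplit : ∑ i ∈ (positions c).filter (· ∉ A), entry c i =
      ∑ i ∈ (positions c).filter (· ∉ A), (entry c i - if i ∈ B then 1 else 0) + B.card := by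
    rw [← hBs, ← Finset.sum_add_distrib]
    refine Finset.sum_congr rfl fun i _ => ?_
    split_ifs with hi
    · have := (Finset.mem_filter.1 (hB hi)).2
      omega
    · simp
  rw [sum_eq_sum_entry c, ← Finset.sum_filter_add_sum_filter_not (positions c) (· ∈ A), hAp, hAs,
    hsplit, h1]
  omega

open Classical in
/-- `𝔇(c)`, by recursion on the weight of `c`: `𝔇(∅) = 1`, and otherwise `𝔇(c)` is the sum of
three double sums over `A ⊆ [2s]¹` and `B ⊆ [2s]^{>1}`, subject to the displayed conditions.
The sign `(-1)^{#B-1}` is written as an integer power. -/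
noncomputable def frakD (c : List ℕ) : H :=
  if c = [] then 1 else
    (∑ A ∈ (onePos c).powerset, ∑ B ∈ (bigPos c).powerset,
      if _h : A ⊆ onePos c ∧ B ⊆ bigPos c ∧ EvenOdd A ∧ 1 ≤ A.card + B.card ∧
          NoEvenOddPair (c.length / 2) B then
        (-1 : ℚ) ^ ((B.card : ℤ) - 1) • (frakD (reduce c A B) * X ^ (A.card + B.card))
      else 0) +
    (∑ A ∈ (onePos c).powerset, ∑ B ∈ (bigPos c).powerset,
      if _h : A ⊆ onePos c ∧ B ⊆ bigPos c ∧ EvenOdd A ∧ 2 ≤ A.card + B.card ∧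
          NoEvenOddPair (c.length / 2) B then
        (-1 : ℚ) ^ ((B.card : ℤ) - 1) • (frakD (reduce c A B) * Y * X ^ (A.card + B.card - 1))
      else 0) +
    (∑ A ∈ (onePos c).powerset, ∑ B ∈ (bigPos c).powerset,
      if _h : A ⊆ onePos c ∧ B ⊆ bigPos c ∧ OddEven A ∧ 2 ≤ A.card + B.card ∧
          NoOddEvenPair (c.length / 2) B then
        (-1 : ℚ) ^ B.card • (frakD (reduce c A B) * Y * X ^ (A.card + B.card - 1))
      else 0)
termination_by c.sum
decreasing_by
  all_goals
    have := reduce_sum_add _h.1 _h.2.1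
    omega

theorem frakD_nil : frakD [] = 1 := by
  rw [frakD, if_pos rfl]

open Classical in
/-- The defining recurrence of `𝔇`. -/
theorem frakD_rec (s : ℕ) (c : List ℕ) (hs : 0 < s) (hlen : c.length = 2 * s) :
    frakD c =
      (∑ A ∈ (onePos c).powerset with EvenOdd A,
        ∑ B ∈ (bigPos c).powerset with 1 ≤ A.card + B.card ∧ NoEvenOddPair s B,
          (-1 : ℚ) ^ ((B.card : ℤ) - 1) • (frakD (reduce c A B) * X ^ (A.card + B.card))) +
      (∑ A ∈ (onePos c).powerset with EvenOdd A,
        ∑ B ∈ (bigPos c).powerset with 2 ≤ A.card + B.card ∧ NoEvenOddPair s B,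
          (-1 : ℚ) ^ ((B.card : ℤ) - 1) •
            (frakD (reduce c A B) * Y * X ^ (A.card + B.card - 1))) +
      (∑ A ∈ (onePos c).powerset with OddEven A,
        ∑ B ∈ (bigPos c).powerset with 2 ≤ A.card + B.card ∧ NoOddEvenPair s B,
          (-1 : ℚ) ^ B.card •
            (frakD (reduce c A B) * Y * X ^ (A.card + B.card - 1))) := by
  have hc : c ≠ [] := by
    rintro rfl
    simp at hlen
    omega
  have hs2 : c.length / 2 = s := by omega
  have key : ∀ (P : Finset ℕ → Prop) (Q : Finset ℕ → Finset ℕ → Prop)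
      (f : Finset ℕ → Finset ℕ → H)
      [∀ A B, Decidable (A ⊆ onePos c ∧ B ⊆ bigPos c ∧ P A ∧ Q A B)]
      [DecidablePred P] [∀ A, DecidablePred (Q A)],
      (∑ A ∈ (onePos c).powerset, ∑ B ∈ (bigPos c).powerset,
        if A ⊆ onePos c ∧ B ⊆ bigPos c ∧ P A ∧ Q A B then f A B else 0) =
      ∑ A ∈ (onePos c).powerset with P A, ∑ B ∈ (bigPos c).powerset with Q A B, f A B := by
    intro P Q f _ _ _
    rw [Finset.sum_filter]
    refine Finset.sum_congr rfl fun A hA => ?_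
    rw [Finset.mem_powerset] at hA
    split_ifs with hP
    · rw [Finset.sum_filter]
      refine Finset.sum_congr rfl fun B hB => ?_
      rw [Finset.mem_powerset] at hB
      simp [hA, hB, hP]
    · simp [hP]
  rw [frakD, if_neg hc, hs2]
  simp only [dite_eq_ite]
  rw [← key EvenOdd (fun A B => 1 ≤ A.card + B.card ∧ NoEvenOddPair s B),
    ← key EvenOdd (fun A B => 2 ≤ A.card + B.card ∧ NoEvenOddPair s B),
    ← key OddEven (fun A B => 2 ≤ A.card + B.card ∧ NoOddEvenPair s B)]

theorem frakD_mem_aux (n : ℕ) : ∀ c : List ℕ, c.sum = n → c ≠ [] →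
    ∃ h ∈ Algebra.adjoin ℚ ({X, Y * X} : Set H), frakD c = Y * X * h := by
  induction n using Nat.strong_induction_on with
  | _ n ih =>
  intro c hn hc
  let S : Submodule ℚ H :=
    (Algebra.adjoin ℚ ({X, Y * X} : Set H)).toSubmodule.map (LinearMap.mulLeft ℚ (Y * X))
  have hS : ∀ a : H, a ∈ S ↔ ∃ h ∈ Algebra.adjoin ℚ ({X, Y * X} : Set H), a = Y * X * h := by
    intro a
    simp [S, Submodule.mem_map, eq_comm, mul_assoc]
  have hX : X ∈ Algebra.adjoin ℚ ({X, Y * X} : Set H) := Algebra.subset_adjoin (by simp)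
  have hYX : Y * X ∈ Algebra.adjoin ℚ ({X, Y * X} : Set H) := Algebra.subset_adjoin (by simp)
  have hSmul : ∀ a ∈ S, ∀ b ∈ Algebra.adjoin ℚ ({X, Y * X} : Set H), a * b ∈ S := by
    intro a ha b hb
    obtain ⟨h, hh, rfl⟩ := (hS a).1 ha
    exact (hS _).2 ⟨h * b, mul_mem hh hb, mul_assoc _ _ _⟩
  have hpow : ∀ m, 2 ≤ m → Y * X ^ (m - 1) = Y * X * X ^ (m - 2) := by
    intro m hm
    rw [mul_assoc, ← pow_succ', show m - 2 + 1 = m - 1 by omega]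
  rw [← hS]
  have hx : ∀ A B : Finset ℕ, A ⊆ onePos c → B ⊆ bigPos c → EvenOdd A → 1 ≤ A.card + B.card →
      frakD (reduce c A B) ∈ S := by
    intro A B hA hB hAe hcard
    have hsum := reduce_sum_add hA hB
    refine (hS _).2 (ih _ (by omega) _ rfl ?_)
    have h1 : (1 : ℕ) ∉ A := by
      intro h
      have h0 := (hAe 1 h).2 odd_one
      have := hA h0
      simp [onePos, positions] at this
    have : 1 ∈ (List.range' 1 c.length).filter (· ∉ A) := by
      simp only [List.mem_filter, List.mem_range'_1, decide_eq_true_eq]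
      have := List.length_pos_iff.2 hc
      exact ⟨by omega, h1⟩
    intro h
    rw [reduce, List.map_eq_nil_iff] at h
    rw [h] at this
    simp at this
  rw [frakD, if_neg hc]
  refine add_mem (add_mem ?_ ?_) ?_ <;>
    refine sum_mem fun A _ => sum_mem fun B _ => ?_ <;> split_ifs with h <;>
    try exact zero_mem _
  · exact S.smul_mem _ (hSmul _ (hx A B h.1 h.2.1 h.2.2.1 h.2.2.2.1) _ (pow_mem hX _))
  · refine S.smul_mem _ ?_
    rw [mul_assoc, hpow _ h.2.2.2.1]
    exact hSmul _ (hx A B h.1 h.2.1 h.2.2.1 (by omega)) _ (mul_mem hYX (pow_mem hX _))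
  · refine S.smul_mem _ ?_
    rw [mul_assoc, hpow _ h.2.2.2.1]
    by_cases hr : reduce c A B = []
    · rw [hr, frakD_nil, one_mul]
      exact (hS _).2 ⟨_, pow_mem hX _, rfl⟩
    · have hsum := reduce_sum_add h.1 h.2.1
      exact hSmul _ ((hS _).2 (ih _ (by omega) _ rfl hr)) _ (mul_mem hYX (pow_mem hX _))

theorem frakD_mem (c : List ℕ) : frakD c ∈ Hge2 := by
  by_cases hc : c = []
  · subst hc
    exact ⟨1, 0, zero_mem _, by rw [frakD_nil, map_one, mul_zero, add_zero]⟩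
  · obtain ⟨h, hh, e⟩ := frakD_mem_aux _ c rfl hc
    exact ⟨0, h, hh, by rw [e, map_zero, zero_add]⟩

/-- The lengths of the maximal blocks of equal letters of a word; for
`y^{c₁} x^{c₂} ⋯ y^{c_{2s-1}} x^{c_{2s}}` with positive exponents it is `(c₁, …, c_{2s})`. -/
def blockLengths : List Letter → List ℕ
  | [] => []
  | [_] => [1]
  | a :: b :: w =>
    if a = b then (blockLengths (b :: w)).modifyHead (· + 1) else 1 :: blockLengths (b :: w)

/-- The linear map `𝒟 : ℋ⁰ → ℋ^{≥ 2}` with `𝒟(y^{c₁} x^{c₂} ⋯ y^{c_{2s-1}} x^{c_{2s}}) = 𝔇(c)`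
and `𝒟(1) = 1`. -/
noncomputable def calD : H0 →ₗ[ℚ] Hge2 :=
  (wordLift fun w => (⟨frakD (blockLengths w.toList), frakD_mem _⟩ : Hge2)).domRestrict H0

/-! ### The maps `Z` and `𝒟` on words -/

theorem takeWhile_replicate_x (m : ℕ) (w : List Letter) (hw : w.head? ≠ some Letter.x) :
    (List.replicate m Letter.x ++ w).takeWhile (· = Letter.x) = List.replicate m Letter.x := by
  induction m with
  | zero => cases w with
    | nil => rfl
    | cons a w => cases a <;> simp_all
  | succ m ih => simp_all [List.replicate_succ]

theorem wordIndex_replicate_x (m : ℕ) (w : List Letter) :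
    wordIndex (List.replicate m Letter.x ++ w) = wordIndex w := by
  induction m with
  | zero => rfl
  | succ m ih => simpa [List.replicate_succ, wordIndex] using ih

theorem toList_of_pow (a : Letter) (m : ℕ) :
    (FreeMonoid.of a ^ m).toList = List.replicate m a := by
  induction m with
  | zero => rfl
  | succ m ih => rw [pow_succ', FreeMonoid.toList_mul, ih]; rfl

theorem toList_eWord_cons (a : ℕ) (k : List ℕ) : (eWord (a :: k)).toList =
    Letter.y :: (List.replicate (a - 1) Letter.x ++ (eWord k).toList) := by
  rw [eWord, List.map_cons, List.prod_cons, FreeMonoid.toList_mul, FreeMonoid.toList_mul,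
    toList_of_pow]
  rfl

theorem wordIndex_eWord (k : List ℕ) (hk : ∀ a ∈ k, 0 < a) :
    wordIndex (eWord k).toList = k := by
  induction k with
  | nil => rfl
  | cons a k ih =>
    have hh : (eWord k).toList.head? ≠ some Letter.x := by
      cases k with
      | nil => simp [eWord]
      | cons b k => simp [toList_eWord_cons]
    rw [toList_eWord_cons, wordIndex, takeWhile_replicate_x _ _ hh, wordIndex_replicate_x,
      ih fun b hb => hk b (by simp [hb])]
    have := hk a (by simp)
    simp
    omega

theorem Z_eWord (k : List ℕ) (hk : IsAdmissible k) :
    Z ⟨ofWord (eWord k), ofWord_eWord_mem hk⟩ = mzv k := by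
  change wordLift _ (ofWord (eWord k)) = _
  rw [wordLift_ofWord, wordIndex_eWord k hk.1]

theorem Z_one (h : (1 : H) ∈ H0) : Z ⟨1, h⟩ = 1 := by
  have h1 : (1 : H) = ofWord 1 := ofWord_one.symm
  change wordLift _ (1 : H) = _
  rw [h1, wordLift_ofWord]
  change ∑' n : MZVRange 0, mzvTerm [] n = 1
  have : Unique (MZVRange 0) :=
    { default := ⟨Fin.elim0, fun i => i.elim0, fun i => i.elim0⟩
      uniq := fun n => Subtype.ext (funext fun i => i.elim0) }
  rw [tsum_eq_single default fun b hb => absurd (Subsingleton.elim b default) hb]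
  simp [mzvTerm]

theorem blockLengths_replicate (a : Letter) (m : ℕ) (w : List Letter)
    (hw : w.head? ≠ some a) :
    blockLengths (List.replicate (m + 1) a ++ w) = (m + 1) :: blockLengths w := by
  induction m with
  | zero => cases w with
    | nil => rfl
    | cons b w =>
      have hab : a ≠ b := by
        rintro rfl
        simp at hw
      simp [blockLengths, hab]
  | succ m ih =>
    rw [List.replicate_succ, List.cons_append]
    rw [List.replicate_succ, List.cons_append] at ih ⊢
    rw [blockLengths, if_pos rfl, ih]
    rfl

theorem blockLengths_blockWord : ∀ (s : ℕ) (c : List ℕ), c.length = 2 * s → (∀ a ∈ c, 0 < a) →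
    blockLengths (blockWord c).toList = c
  | _, [], _, _ => rfl
  | _, [_], h, _ => by simp at h; omega
  | s, a :: b :: t, h, hc => by
    obtain ⟨a, rfl⟩ : ∃ a', a = a' + 1 := ⟨a - 1, by have := hc a (by simp); omega⟩
    obtain ⟨b, rfl⟩ : ∃ b', b = b' + 1 := ⟨b - 1, by have := hc b (by simp); omega⟩
    have ht := blockLengths_blockWord (s - 1) t (by simp at h; omega)
      (fun d hd => hc d (by simp [hd]))
    have hh : (blockWord t).toList.head? ≠ some Letter.x := by
      rcases blockWord_eq (s - 1) t (by simp at h; omega)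
        (fun d hd => hc d (by simp [hd])) with rfl | ⟨w, hw⟩
      · simp [blockWord]
      · rw [hw, mul_assoc, FreeMonoid.toList_mul]
        simp
    rw [blockWord, FreeMonoid.toList_mul, FreeMonoid.toList_mul, toList_of_pow, toList_of_pow,
      List.append_assoc, blockLengths_replicate, blockLengths_replicate _ _ _ hh, ht]
    simp [List.replicate_succ]

theorem calD_blockWord {s : ℕ} {c : List ℕ} (hlen : c.length = 2 * s) (hpos : ∀ a ∈ c, 0 < a) :
    (calD ⟨ofWord (blockWord c), ofWord_blockWord_mem hlen hpos⟩ : H) = frakD c := by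
  change ((wordLift _ (ofWord (blockWord c)) : Hge2) : H) = _
  rw [wordLift_ofWord]
  change frakD (blockLengths (blockWord c).toList) = frakD c
  rw [blockLengths_blockWord s c hlen hpos]

end HoffmanMZV

open HoffmanMZV

namespace HoffmanMZV

/-! The theorem is the limit of an identity that holds exactly at every finite level N.

On the algebraic side, cutting the sums off at N gives linear functionals `truncEval N` on words,
with increments `lastEval N`. Right multiplication by x^m turns `lastEval N` into N^{-m} times
itself, and by y x^{m-1} into N^{-m} times `truncEval N`. The recursion for 𝔇 therefore becomes a
recurrence in N for `truncEval N (𝔇(c))`.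

On the analytic side, the iterated integral of ζ is discretised: W_N(c) sums over chains in {1, ...,
N-1}, where a letter x at p weighs 1/p and a letter y at p weighs 1/(N-p). The inequalities are
weak, except that a y directly after an x lies strictly above it (`weakSum`, `blockSum`). With q =
1/N, the sum of (-1)^{#B} q^{#A+#B} W_{N+1}(c_{(-A)} - δ_B) over the even-odd pairs (A, B) equals
the same sum of W_N over the odd-even pairs (`pairSum_blockSum`). This is the recurrence produced by
𝔇, so `truncEval N (𝔇(c))` = W_N(c) for all N ≥ 1 (`truncEval_frakD`).

As N grows, the left side tends to Z(𝔇(c)), because 𝔇(c) is a combination of words e_l with all l_i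
≥ 2. For the right side, making every y strict gives another sum (`flatSum`) that equals the
truncated multiple zeta value on the nose (`truncSum_eq_flatSum`, by connected sums), and the two
discretisations differ by O((log N)^k / N) for words ending in x (`tendsto_weakSum_sub_truncSum`).

Integrality and homogeneity of the weight follow from the recursion itself, whose only scalars are
signs (`frakD_mem_hoffmanSpan`). -/

/-! ### Truncated multiple zeta values and two discretised iterated integrals. -/

/-- For the reversal `w` of the word `e_{k₁} ⋯ e_{k_r}`, the sum of `1 / (n₁ ^ k₁ ⋯ n_r ^ k_r)`
over `0 < n₁ < ⋯ < n_r = n`. -/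
noncomputable def lastSum : List Letter → ℕ → ℝ
  | [], n => if n = 0 then 1 else 0
  | Letter.x :: w, n => lastSum w n / n
  | Letter.y :: w, n => (∑ b ∈ Finset.range n, lastSum w b) / n

/-- The truncated multiple zeta value `∑_{0 < n₁ < ⋯ < n_r < N} 1 / (n₁ ^ k₁ ⋯ n_r ^ k_r)` of the
reversal `w` of `e_{k₁} ⋯ e_{k_r}`. -/
noncomputable def truncSum (w : List Letter) (N : ℕ) : ℝ := ∑ n ∈ Finset.range N, lastSum w n

/-- The discretised iterated integral of a reversed word in which a letter `y` has to stand
strictly above its predecessor. -/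
noncomputable def flatSum (N : ℕ) : List Letter → ℕ → ℝ
  | [], _ => 1
  | Letter.x :: w, m => ∑ n ∈ Finset.range m, flatSum N w (n + 1) / (n + 1 : ℝ)
  | Letter.y :: w, m => ∑ n ∈ Finset.range m, flatSum N w n / (N - (n + 1) : ℝ)

/-- The discretised iterated integral of a reversed word in which a letter `y` has to stand
strictly above a preceding letter `x`, and all other inequalities are weak. -/
noncomputable def weakSum (N : ℕ) : List Letter → ℕ → ℝ
  | [], _ => 1
  | Letter.x :: w, m => ∑ n ∈ Finset.range m, weakSum N w (n + 1) / (n + 1 : ℝ)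
  | Letter.y :: w, m => ∑ n ∈ Finset.range m,
      weakSum N w (if w.head? = some Letter.y then n + 1 else n) / (N - (n + 1) : ℝ)

theorem flatSum_x_succ (N : ℕ) (w : List Letter) (m : ℕ) : flatSum N (Letter.x :: w) (m + 1) =
    flatSum N (Letter.x :: w) m + flatSum N w (m + 1) / (m + 1 : ℝ) := by
  simp only [flatSum, Finset.sum_range_succ]

theorem flatSum_y_succ (N : ℕ) (w : List Letter) (m : ℕ) : flatSum N (Letter.y :: w) (m + 1) =
    flatSum N (Letter.y :: w) m + flatSum N w m / (N - (m + 1) : ℝ) := by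
  simp only [flatSum, Finset.sum_range_succ]

theorem weakSum_x_succ (N : ℕ) (w : List Letter) (m : ℕ) : weakSum N (Letter.x :: w) (m + 1) =
    weakSum N (Letter.x :: w) m + weakSum N w (m + 1) / (m + 1 : ℝ) := by
  simp only [weakSum, Finset.sum_range_succ]

theorem weakSum_y_succ (N : ℕ) (w : List Letter) (m : ℕ) : weakSum N (Letter.y :: w) (m + 1) =
    weakSum N (Letter.y :: w) m +
      weakSum N w (if w.head? = some Letter.y then m + 1 else m) / (N - (m + 1) : ℝ) := by
  simp only [weakSum, Finset.sum_range_succ]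

theorem weakSum_zero_of_cons (N : ℕ) (a : Letter) (w : List Letter) :
    weakSum N (a :: w) 0 = 0 := by
  cases a <;> simp [weakSum]

/-! ### Connected sums: truncated values equal discretised integrals exactly. -/

/-- The connector `binom(m, n) / binom(M, n)`. -/
noncomputable def connector (M n m : ℕ) : ℝ := (m.choose n : ℝ) / (M.choose n : ℝ)

theorem connector_self {M n : ℕ} (h : n ≤ M) : connector M n M = 1 :=
  div_self (by exact_mod_cast (Nat.choose_pos h).ne')

theorem connector_of_lt {M n m : ℕ} (h : m < n) : connector M n m = 0 := by
  simp [connector, Nat.choose_eq_zero_of_lt h]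

/-- This moves a letter x across the connector: the factor 1/n of the series becomes the factor
1/(m+1) of the integral. It is Pascal's rule combined with the absorption identity for binomials. -/
theorem connector_x (M n m : ℕ) (hn : n ≠ 0) :
    connector M n (m + 1) / n - connector M n m / n = connector M n (m + 1) / (m + 1) := by
  obtain ⟨n, rfl⟩ := Nat.exists_eq_succ_of_ne_zero hn
  have h1 : ((m : ℝ) + 1) * m.choose n = (m + 1).choose (n + 1) * ((n : ℝ) + 1) := by
    exact_mod_cast Nat.add_one_mul_choose_eq m n
  have h2 : ((m + 1).choose (n + 1) : ℝ) = m.choose n + m.choose (n + 1) := by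
    exact_mod_cast Nat.choose_succ_succ m n
  have hn' : (n + 1 : ℝ) ≠ 0 := by positivity
  have hm' : (m + 1 : ℝ) ≠ 0 := by positivity
  have h3 : (((m + 1).choose (n + 1) : ℝ) - m.choose (n + 1)) / (n + 1) =
      (m + 1).choose (n + 1) / (m + 1) := by
    rw [div_eq_div_iff hn' hm']
    linear_combination ((m : ℝ) + 1) * h2 + h1
  simp only [connector, Nat.succ_eq_add_one, Nat.cast_add, Nat.cast_one]
  rw [div_right_comm, div_right_comm _ _ ((n : ℝ) + 1), div_right_comm _ _ ((m : ℝ) + 1), ← h3]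
  ring

/-- A difference in `m` is converted into a difference in `b`, so that summing over `b` telescopes.
-/
theorem connector_y {M b m : ℕ} (hb : b < M) (hm : m < M) :
    (connector M (b + 1) (m + 1) - connector M (b + 1) m) / (b + 1) =
      (connector M b m - connector M (b + 1) m) / (M - m : ℝ) := by
  have hM : (M - m : ℝ) ≠ 0 := by
    have : (m : ℝ) < M := by exact_mod_cast hm
    linarith
  have hbM : (M - b : ℝ) ≠ 0 := by
    have : (b : ℝ) < M := by exact_mod_cast hb
    linarith
  have h2 : ((m + 1).choose (b + 1) : ℝ) = m.choose b + m.choose (b + 1) := by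
    exact_mod_cast Nat.choose_succ_succ m b
  have h0 : ∀ k : ℕ, ((b + 1 : ℝ)) * k.choose (b + 1) = k.choose b * (k - b) := by
    intro k
    rcases le_or_gt b k with h | h
    · have := Nat.choose_succ_right_eq k b
      rw [← Nat.cast_sub h, mul_comm]
      exact_mod_cast this
    · simp [Nat.choose_eq_zero_of_lt h, Nat.choose_eq_zero_of_lt (h.trans (Nat.lt_succ_self b))]
  have hb1 : (b + 1 : ℝ) ≠ 0 := by positivity
  have e1 : ∀ k : ℕ, (k.choose (b + 1) : ℝ) = k.choose b * (k - b) / (b + 1) := fun k => by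
    rw [eq_div_iff hb1, ← h0 k, mul_comm]
  have hMb : (M.choose b : ℝ) ≠ 0 := by exact_mod_cast (Nat.choose_pos hb.le).ne'
  simp only [connector]
  rw [h2, e1 m, e1 M]
  field_simp
  ring

/-- This moves a letter y across the connector. The upper end of the telescoping sum vanishes
because binom(m, M) = 0 for m < M. -/
theorem sum_connector_y {M n m : ℕ} (hn : n ≤ M) (hm : m < M) :
    ∑ b ∈ Finset.Ico n M, (connector M (b + 1) (m + 1) - connector M (b + 1) m) / (b + 1) =
      connector M n m / (M - m : ℝ) := by
  have h : ∀ b ∈ Finset.Ico n M,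
      (connector M (b + 1) (m + 1) - connector M (b + 1) m) / (b + 1) =
        -(connector M (b + 1) m - connector M b m) / (M - m : ℝ) := by
    intro b hb
    rw [connector_y (Finset.mem_Ico.1 hb).2 hm, neg_sub]
  rw [Finset.sum_congr rfl h, ← Finset.sum_div, Finset.sum_neg_distrib,
    Finset.sum_Ico_sub (fun b => connector M b m) hn, connector_of_lt hm]
  simp

theorem lastSum_zero_of_cons (a : Letter) (w : List Letter) : lastSum (a :: w) 0 = 0 := by
  cases a <;> simp [lastSum]

/-- The connected sum interpolating between truncated multiple zeta values and discretised
iterated integrals. -/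
theorem sum_lastSum_mul_connector (M : ℕ) (w : List Letter)
    (hw : w.getLast? ≠ some Letter.x) : ∀ m ≤ M,
    ∑ n ∈ Finset.range (M + 1), lastSum w n * connector M n m = flatSum (M + 1) w m := by
  induction w with
  | nil =>
    intro m _
    simp [lastSum, flatSum, connector]
  | cons a w ih =>
    have hw' : w.getLast? ≠ some Letter.x := by
      cases w with
      | nil => simp
      | cons b w => simpa using hw
    intro m
    induction m with
    | zero =>
      intro _
      rw [Finset.sum_range_succ', lastSum_zero_of_cons,
        Finset.sum_eq_zero fun n _ => by rw [connector_of_lt (Nat.succ_pos n), mul_zero]]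
      cases a <;> simp [flatSum]
    | succ m ihm =>
      intro hm
      cases a with
      | x =>
        rw [flatSum_x_succ, ← ihm (by omega), ← ih hw' _ hm,
          Finset.sum_div, ← Finset.sum_add_distrib]
        refine Finset.sum_congr rfl fun n _ => ?_
        -- `connector_x` fails at n = 0. There both sides vanish, because `hw` rules out an empty
        -- `w`.
        rcases eq_or_ne n 0 with rfl | hn
        · rcases w with _ | ⟨a, w⟩
          · simp at hw
          · simp [lastSum_zero_of_cons]
        · have := connector_x M n m hn
          simp only [lastSum]
          linear_combination lastSum w n * this
      | y =>
        rw [flatSum_y_succ, ← ihm (by omega), ← ih hw' _ (by omega), ← sub_eq_iff_eq_add',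
          ← Finset.sum_sub_distrib, Finset.sum_range_succ',
          lastSum_zero_of_cons]
        have e : ((M + 1 : ℕ) : ℝ) - (m + 1) = M - m := by push_cast; ring
        rw [e, Finset.sum_div]
        -- The connector at `n` is expanded into a sum over b ≥ n. Exchanging the two summations
        -- then rebuilds the inner sum over n ≤ b in `lastSum (Letter.y :: w) (b + 1)`.
        have h1 : ∀ n ∈ Finset.range (M + 1), lastSum w n * connector M n m / (M - m : ℝ) =
            ∑ b ∈ Finset.Ico n M, lastSum w n *
              ((connector M (b + 1) (m + 1) - connector M (b + 1) m) / (b + 1)) := by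
          intro n hn
          rw [← Finset.mul_sum,
            sum_connector_y (by have := Finset.mem_range.1 hn; omega) (by omega), mul_div_assoc]
        rw [Finset.sum_congr rfl h1, Finset.sum_sigma', zero_mul, zero_mul, sub_zero, add_zero]
        have h2 : ∀ b ∈ Finset.range M,
            lastSum (Letter.y :: w) (b + 1) * connector M (b + 1) (m + 1) -
              lastSum (Letter.y :: w) (b + 1) * connector M (b + 1) m =
            ∑ n ∈ Finset.range (b + 1), lastSum w n *
              ((connector M (b + 1) (m + 1) - connector M (b + 1) m) / (b + 1)) := by
          intro b _
          rw [← Finset.sum_mul, lastSum]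
          push_cast
          ring
        rw [Finset.sum_congr rfl h2, Finset.sum_sigma']
        refine Finset.sum_bij' (fun p _ => ⟨p.2, p.1⟩) (fun p _ => ⟨p.2, p.1⟩) ?_ ?_ ?_ ?_ ?_
        · simp only [Finset.mem_sigma, Finset.mem_range, Finset.mem_Ico]
          omega
        · simp only [Finset.mem_sigma, Finset.mem_range, Finset.mem_Ico]
          omega
        all_goals simp

theorem truncSum_eq_flatSum (M : ℕ) (w : List Letter) (hw : w.getLast? ≠ some Letter.x) :
    truncSum w (M + 1) = flatSum (M + 1) w M := by
  rw [← sum_lastSum_mul_connector M w hw M le_rfl, truncSum]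
  refine Finset.sum_congr rfl fun n hn => ?_
  rw [connector_self (by have := Finset.mem_range.1 hn; omega), mul_one]


/-! ### Harmonic bounds and the comparison of the two discretisations. -/

/-- `1` plus the `M`-th harmonic number. -/
noncomputable def harm (M : ℕ) : ℝ := 1 + ∑ n ∈ Finset.range M, 1 / (n + 1 : ℝ)

theorem one_le_harm (M : ℕ) : 1 ≤ harm M := by
  have : 0 ≤ ∑ n ∈ Finset.range M, 1 / (n + 1 : ℝ) := Finset.sum_nonneg fun n _ => by positivity
  rw [harm]
  linarith

theorem harm_mono {m M : ℕ} (h : m ≤ M) : harm m ≤ harm M := by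
  have := Finset.sum_le_sum_of_subset_of_nonneg (Finset.range_mono h)
    (f := fun n : ℕ => 1 / (n + 1 : ℝ)) fun n _ _ => by positivity
  rw [harm, harm]
  linarith

theorem sum_inv_le_harm {m M : ℕ} (h : m ≤ M) :
    ∑ n ∈ Finset.range m, 1 / (n + 1 : ℝ) ≤ harm M := by
  have := harm_mono h
  rw [harm] at this
  linarith

theorem sum_inv_sub_le_harm {m M : ℕ} (h : m ≤ M) :
    ∑ n ∈ Finset.range m, 1 / ((M : ℝ) - n) ≤ harm M := by
  have h1 : ∑ n ∈ Finset.range m, 1 / ((M : ℝ) - n) ≤ ∑ n ∈ Finset.range M, 1 / ((M : ℝ) - n) := by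
    refine Finset.sum_le_sum_of_subset_of_nonneg (Finset.range_mono h) fun n hn _ => ?_
    have : (n : ℝ) < M := by exact_mod_cast Finset.mem_range.1 hn
    exact one_div_nonneg.2 (by linarith)
  refine h1.trans (le_trans (le_of_eq ?_) (sum_inv_le_harm le_rfl))
  rw [← Finset.sum_range_reflect]
  refine Finset.sum_congr rfl fun n hn => ?_
  have := Finset.mem_range.1 hn
  rw [show M - 1 - n = M - (n + 1) by omega, Nat.cast_sub (by omega)]
  push_cast
  ring

/-- Induction on `m` using 2/(j+1) + 1/j² ≤ 2/j for j ≥ 1. The bound has the shape of the error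
carried through `abs_weakSum_sub_flatSum_le`. -/
theorem sum_inv_sub_sq_le {m M : ℕ} (h : m ≤ M) :
    ∑ n ∈ Finset.range m, 1 / ((M : ℝ) - n) ^ 2 ≤ 2 / ((M : ℝ) + 1 - m) := by
  induction m with
  | zero => simp; positivity
  | succ m ih =>
    rw [Finset.sum_range_succ]
    have hj : (1 : ℝ) ≤ M - m := by
      have : ((m + 1 : ℕ) : ℝ) ≤ M := by exact_mod_cast h
      push_cast at this
      linarith
    have h2 : 2 / ((M : ℝ) + 1 - m) + 1 / ((M : ℝ) - m) ^ 2 ≤ 2 / ((M : ℝ) - m) := by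
      set j : ℝ := M - m
      rw [show (M : ℝ) + 1 - m = j + 1 by simp only [j]; ring]
      rw [div_add_div _ _ (by positivity) (by positivity), div_le_div_iff₀ (by positivity)
        (by positivity)]
      nlinarith [mul_nonneg (show 0 ≤ j by linarith) (show 0 ≤ j - 1 by linarith)]
    have := ih (by omega)
    push_cast
    rw [show (M : ℝ) + 1 - (m + 1) = M - m by ring]
    linarith

theorem weakSum_bound (M : ℕ) (w : List Letter) : ∀ m ≤ M,
    0 ≤ weakSum (M + 1) w m ∧ weakSum (M + 1) w m ≤ harm M ^ w.length := by
  have hL := one_le_harm M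
  have gen : ∀ (k m : ℕ) (f g : ℕ → ℝ), (∀ n < m, 0 ≤ f n ∧ f n ≤ harm M ^ k) →
      (∀ n < m, 0 ≤ g n) → (∑ n ∈ Finset.range m, g n ≤ harm M) →
      0 ≤ ∑ n ∈ Finset.range m, f n * g n ∧
        ∑ n ∈ Finset.range m, f n * g n ≤ harm M ^ (k + 1) := by
    intro k m f g hf hg hs
    refine ⟨Finset.sum_nonneg fun n hn => mul_nonneg (hf n (Finset.mem_range.1 hn)).1
      (hg n (Finset.mem_range.1 hn)), ?_⟩
    calc ∑ n ∈ Finset.range m, f n * g n ≤ ∑ n ∈ Finset.range m, harm M ^ k * g n :=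
          Finset.sum_le_sum fun n hn => mul_le_mul_of_nonneg_right
            (hf n (Finset.mem_range.1 hn)).2 (hg n (Finset.mem_range.1 hn))
      _ = harm M ^ k * ∑ n ∈ Finset.range m, g n := by rw [Finset.mul_sum]
      _ ≤ harm M ^ k * harm M := mul_le_mul_of_nonneg_left hs (by positivity)
      _ = _ := (pow_succ _ _).symm
  induction w with
  | nil => simp [weakSum]
  | cons a w ih =>
    intro m hm
    cases a with
    | x =>
      have := gen w.length m (fun n => weakSum (M + 1) w (n + 1)) (fun n => 1 / (n + 1 : ℝ))
        (fun n hn => ih _ (by omega)) (fun n _ => by positivity) (sum_inv_le_harm hm)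
      simpa only [weakSum, List.length_cons, mul_one_div] using this
    | y =>
      have := gen w.length m
        (fun n => weakSum (M + 1) w (if w.head? = some Letter.y then n + 1 else n))
        (fun n => 1 / ((M : ℝ) - n)) (fun n hn => ih _ (by split_ifs <;> omega))
        (fun n hn => one_div_nonneg.2 (by
          have : (n : ℝ) < M := by exact_mod_cast (show n < M by omega)
          linarith)) (sum_inv_sub_le_harm hm)
      simpa only [weakSum, List.length_cons, mul_one_div, Nat.cast_add, Nat.cast_one,
        add_sub_add_right_eq_sub] using this

/-- The error K/(M+1-m) is not small at m = M. A final letter x repairs this by partial fractions: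
1/((n+1)(M-n)) is 1/(M+1) times 1/(n+1) + 1/(M-n), which sums to O(`harm M`/(M+1)) uniformly in `m`.
This is where admissibility enters. -/
theorem abs_weakSum_sub_flatSum_x {M m : ℕ} (hm : m ≤ M) (w : List Letter) {K : ℝ} (hK : 0 ≤ K)
    (h : ∀ n ≤ M, |weakSum (M + 1) w n - flatSum (M + 1) w n| ≤ K / ((M : ℝ) + 1 - n)) :
    |weakSum (M + 1) (Letter.x :: w) m - flatSum (M + 1) (Letter.x :: w) m| ≤
      2 * K * harm M / ((M : ℝ) + 1) := by
  simp only [weakSum, flatSum]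
  rw [← Finset.sum_sub_distrib]
  refine (Finset.abs_sum_le_sum_abs _ _).trans ?_
  have h1 : ∀ n ∈ Finset.range m, |weakSum (M + 1) w (n + 1) / (n + 1 : ℝ) -
      flatSum (M + 1) w (n + 1) / (n + 1 : ℝ)| ≤
      K / ((M : ℝ) + 1) * (1 / (n + 1 : ℝ) + 1 / ((M : ℝ) - n)) := by
    intro n hn
    have hn' := Finset.mem_range.1 hn
    have hp : (0 : ℝ) < M - n := by
      have : (n : ℝ) < M := by exact_mod_cast (show n < M by omega)
      linarith
    have := h (n + 1) (by omega)
    rw [← sub_div, abs_div, abs_of_pos (show (0 : ℝ) < n + 1 by positivity),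
      div_le_iff₀ (by positivity)]
    refine this.trans (le_of_eq ?_)
    push_cast
    rw [show (M : ℝ) + 1 - (n + 1) = M - n by ring]
    field_simp
    ring
  refine (Finset.sum_le_sum h1).trans ?_
  rw [← Finset.mul_sum, Finset.sum_add_distrib]
  have := add_le_add (sum_inv_le_harm hm) (sum_inv_sub_le_harm hm)
  calc _ ≤ K / ((M : ℝ) + 1) * (harm M + harm M) :=
        mul_le_mul_of_nonneg_left this (by positivity)
    _ = _ := by ring

/-- The sums differ only by the diagonal terms where two consecutive letters y share a position.
Such a diagonal carries the weight 1/(M-n)², whose sum is O(1/(M+1-m)), so the shape of the error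
survives the induction on the word. -/
theorem abs_weakSum_sub_flatSum_le (M : ℕ) (w : List Letter) : ∀ m ≤ M,
    |weakSum (M + 1) w m - flatSum (M + 1) w m| ≤
      4 ^ w.length * harm M ^ w.length / ((M : ℝ) + 1 - m) := by
  have hL := one_le_harm M
  have hpos : ∀ m ≤ M, (0 : ℝ) < (M : ℝ) + 1 - m := by
    intro m hm
    have : (m : ℝ) ≤ M := by exact_mod_cast hm
    linarith
  induction w with
  | nil =>
    intro m hm
    have := hpos m hm
    simp only [weakSum, flatSum, sub_self, abs_zero]
    positivity
  | cons a w ih =>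
    intro m hm
    have hp := hpos m hm
    have hK : (0 : ℝ) ≤ 4 ^ w.length * harm M ^ w.length := by positivity
    cases a with
    | x =>
      refine (abs_weakSum_sub_flatSum_x hm w hK ih).trans ?_
      rw [List.length_cons, pow_succ, pow_succ]
      refine div_le_div₀ (by positivity) ?_ hp (by
        have : (0 : ℝ) ≤ m := Nat.cast_nonneg m
        linarith)
      have : (0 : ℝ) ≤ 4 ^ w.length * harm M ^ w.length * harm M := by positivity
      linarith
    | y =>
      -- The difference splits into the diagonal summand of `weakSum`, present only when `w` starts
      -- with y, and the inductive error at `n`, which is at most its bound at `m`.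
      have key : ∀ n < m, |weakSum (M + 1) w (if w.head? = some Letter.y then n + 1 else n) -
          flatSum (M + 1) w n| ≤ harm M ^ w.length * (1 / ((M : ℝ) - n)) +
            4 ^ w.length * harm M ^ w.length / ((M : ℝ) + 1 - m) := by
        intro n hn
        have hp' : (0 : ℝ) < M - n := by
          have : (n : ℝ) < M := by exact_mod_cast (show n < M by omega)
          linarith
        have e1 : |weakSum (M + 1) w n - flatSum (M + 1) w n| ≤
            4 ^ w.length * harm M ^ w.length / ((M : ℝ) + 1 - m) := by
          refine (ih n (by omega)).trans (div_le_div_of_nonneg_left hK hp ?_)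
          have : (n : ℝ) ≤ m := by exact_mod_cast hn.le
          linarith
        have e2 : |weakSum (M + 1) w (if w.head? = some Letter.y then n + 1 else n) -
            weakSum (M + 1) w n| ≤ harm M ^ w.length * (1 / ((M : ℝ) - n)) := by
          split_ifs with hy
          · obtain ⟨w', rfl⟩ : ∃ w', w = Letter.y :: w' := by
              cases w with
              | nil => simp at hy
              | cons b w' => exact ⟨w', by simpa using hy⟩
            rw [weakSum_y_succ, add_sub_cancel_left]
            obtain ⟨h0, h1⟩ := weakSum_bound M w'
              (if w'.head? = some Letter.y then n + 1 else n) (by split_ifs <;> omega)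
            rw [show ((M + 1 : ℕ) : ℝ) - (n + 1) = M - n by push_cast; ring, mul_one_div,
              abs_of_nonneg (by positivity)]
            refine div_le_div_of_nonneg_right (h1.trans ?_) hp'.le
            exact pow_le_pow_right₀ hL (by simp)
          · rw [sub_self, abs_zero]
            positivity
        calc _ = |(weakSum (M + 1) w (if w.head? = some Letter.y then n + 1 else n) -
              weakSum (M + 1) w n) + (weakSum (M + 1) w n - flatSum (M + 1) w n)| := by
              rw [sub_add_sub_cancel]
          _ ≤ _ := (abs_add_le _ _).trans (add_le_add e2 e1)
      simp only [weakSum, flatSum]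
      rw [← Finset.sum_sub_distrib]
      refine (Finset.abs_sum_le_sum_abs _ _).trans ?_
      have h1 : ∀ n ∈ Finset.range m,
          |weakSum (M + 1) w (if w.head? = some Letter.y then n + 1 else n) /
            (((M + 1 : ℕ) : ℝ) - (n + 1)) - flatSum (M + 1) w n / (((M + 1 : ℕ) : ℝ) - (n + 1))| ≤
          harm M ^ w.length * (1 / ((M : ℝ) - n) ^ 2) +
            4 ^ w.length * harm M ^ w.length / ((M : ℝ) + 1 - m) * (1 / ((M : ℝ) - n)) := by
        intro n hn
        have hn' := Finset.mem_range.1 hn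
        have hp' : (0 : ℝ) < M - n := by
          have : (n : ℝ) < M := by exact_mod_cast (show n < M by omega)
          linarith
        rw [show ((M + 1 : ℕ) : ℝ) - (n + 1) = M - n by push_cast; ring, ← sub_div, abs_div,
          abs_of_pos hp', div_eq_mul_one_div]
        calc _ ≤ (harm M ^ w.length * (1 / ((M : ℝ) - n)) +
            4 ^ w.length * harm M ^ w.length / ((M : ℝ) + 1 - m)) * (1 / ((M : ℝ) - n)) :=
              mul_le_mul_of_nonneg_right (key n hn') (by positivity)
          _ = _ := by rw [← one_div_pow]; ring
      refine (Finset.sum_le_sum h1).trans ?_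
      rw [Finset.sum_add_distrib, ← Finset.mul_sum, ← Finset.mul_sum]
      have h2 : harm M ^ w.length * ∑ n ∈ Finset.range m, 1 / ((M : ℝ) - n) ^ 2 ≤
          (2 * harm M ^ w.length) / ((M : ℝ) + 1 - m) := by
        refine (mul_le_mul_of_nonneg_left (sum_inv_sub_sq_le hm) (by positivity)).trans
          (le_of_eq ?_)
        ring
      have h3 : 4 ^ w.length * harm M ^ w.length / ((M : ℝ) + 1 - m) *
          ∑ n ∈ Finset.range m, 1 / ((M : ℝ) - n) ≤
          4 ^ w.length * harm M ^ w.length * harm M / ((M : ℝ) + 1 - m) := by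
        refine (mul_le_mul_of_nonneg_left (sum_inv_sub_le_harm hm) (by positivity)).trans
          (le_of_eq ?_)
        ring
      refine (add_le_add h2 h3).trans ?_
      rw [← add_div]
      refine div_le_div_of_nonneg_right ?_ hp.le
      rw [List.length_cons, pow_succ, pow_succ]
      have h4 : (1 : ℝ) ≤ 4 ^ w.length := one_le_pow₀ (by norm_num)
      have h5 : harm M ^ w.length ≤ 4 ^ w.length * harm M ^ w.length * harm M := by
        have h6 : harm M ^ w.length ≤ 4 ^ w.length * harm M ^ w.length :=
          le_mul_of_one_le_left (by positivity) h4
        exact h6.trans (le_mul_of_one_le_right hK hL)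
      have h6 : 0 ≤ harm M ^ w.length := by positivity
      linarith

/-- The exponent 1/2 is a convenient number in (0, 1): divided by M the bound still tends to 0, and
divided by M² it is still summable. -/
theorem exists_harm_pow_le (k : ℕ) : ∃ C : ℝ, 0 ≤ C ∧ ∀ M : ℕ,
    harm M ^ k ≤ C * ((M : ℝ) + 1) ^ (1 / 2 : ℝ) := by
  -- Chosen so that εk ≤ 1/2; the summand 1 keeps it meaningful for k = 0.
  set ε : ℝ := 1 / (2 * (k + 1)) with hε
  have hε0 : 0 < ε := by positivity
  refine ⟨(2 + 1 / ε) ^ k, by positivity, fun M => ?_⟩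
  have hM : (1 : ℝ) ≤ (M : ℝ) + 1 := by
    have : (0 : ℝ) ≤ M := Nat.cast_nonneg M
    linarith
  have h1 : harm M ≤ 2 + Real.log ((M : ℝ) + 1) := by
    have h2 := harmonic_le_one_add_log M
    have h3 : ((harmonic M : ℚ) : ℝ) = ∑ n ∈ Finset.range M, 1 / (n + 1 : ℝ) := by
      simp [harmonic]
    rw [h3] at h2
    rw [harm]
    rcases Nat.eq_zero_or_pos M with rfl | h
    · simp
    · have : Real.log M ≤ Real.log ((M : ℝ) + 1) :=
        Real.log_le_log (by exact_mod_cast h) (by linarith)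
      linarith
  have h2 : Real.log ((M : ℝ) + 1) ≤ ((M : ℝ) + 1) ^ ε / ε :=
    Real.log_le_rpow_div (by linarith) hε0
  have h3 : (1 : ℝ) ≤ ((M : ℝ) + 1) ^ ε := Real.one_le_rpow hM hε0.le
  have h4 : harm M ≤ (2 + 1 / ε) * ((M : ℝ) + 1) ^ ε := by
    have : (2 + 1 / ε) * ((M : ℝ) + 1) ^ ε =
        2 * ((M : ℝ) + 1) ^ ε + ((M : ℝ) + 1) ^ ε / ε := by ring
    linarith
  calc harm M ^ k ≤ ((2 + 1 / ε) * ((M : ℝ) + 1) ^ ε) ^ k :=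
        pow_le_pow_left₀ (by linarith [one_le_harm M]) h4 k
    _ = (2 + 1 / ε) ^ k * (((M : ℝ) + 1) ^ (ε * k)) := by
        rw [mul_pow, Real.rpow_mul (by linarith), Real.rpow_natCast]
    _ ≤ _ := by
        refine mul_le_mul_of_nonneg_left ?_ (by positivity)
        refine Real.rpow_le_rpow_of_exponent_le hM ?_
        rw [hε, one_div_mul_eq_div, div_le_div_iff₀ (by positivity) (by norm_num)]
        linarith

open Filter Topology in
theorem tendsto_weakSum_sub_truncSum (w : List Letter)
    (hw : (Letter.x :: w).getLast? ≠ some Letter.x) :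
    Tendsto (fun M : ℕ => weakSum (M + 1) (Letter.x :: w) M - truncSum (Letter.x :: w) (M + 1))
      atTop (𝓝 0) := by
  obtain ⟨C, hC, h⟩ := exists_harm_pow_le (w.length + 1)
  have hb : ∀ M : ℕ, |weakSum (M + 1) (Letter.x :: w) M - truncSum (Letter.x :: w) (M + 1)| ≤
      (2 * 4 ^ w.length * C) * ((M + 1 : ℕ) : ℝ) ^ (-(1 / 2) : ℝ) := by
    intro M
    rw [truncSum_eq_flatSum M _ hw]
    refine (abs_weakSum_sub_flatSum_x le_rfl w (mul_nonneg (by positivity)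
      (pow_nonneg (by linarith [one_le_harm M]) _)) (abs_weakSum_sub_flatSum_le M w)).trans ?_
    have hM : (0 : ℝ) < (M : ℝ) + 1 := by positivity
    have e : ((M : ℝ) + 1) ^ (-(1 / 2) : ℝ) = ((M : ℝ) + 1) ^ (1 / 2 : ℝ) / ((M : ℝ) + 1) := by
      rw [eq_div_iff hM.ne', ← Real.rpow_add_one hM.ne']
      norm_num
    push_cast
    rw [e, ← mul_div_assoc]
    refine div_le_div_of_nonneg_right ?_ hM.le
    have := mul_le_mul_of_nonneg_left (h M) (show (0 : ℝ) ≤ 2 * 4 ^ w.length by positivity)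
    rw [pow_succ] at this
    linarith
  refine squeeze_zero_norm hb ?_
  rw [← mul_zero (2 * 4 ^ w.length * C)]
  refine Tendsto.const_mul _ ?_
  exact ((tendsto_rpow_neg_atTop (by norm_num)).comp tendsto_natCast_atTop_atTop).comp
    (tendsto_add_atTop_nat 1)


/-! ### Convergence of the series, and multiple zeta values as limits of truncations. -/

/-- The bounds are proved in one induction because they feed each other: a letter x uses the bound
on the last term, a letter y the bound on the truncated sum. -/
theorem lastSum_bounds (w : List Letter) : ∀ n, 0 ≤ lastSum w n ∧
    (∀ a w', w = a :: w' → lastSum w (n + 1) ≤ harm n ^ w'.length / (n + 1 : ℝ)) ∧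
    0 ≤ truncSum w n ∧ truncSum w (n + 1) ≤ harm n ^ w.length := by
  have trunc : ∀ v : List Letter, (∀ n, 0 ≤ lastSum v n) → ∀ n, 0 ≤ truncSum v n :=
    fun v h n => Finset.sum_nonneg fun b _ => h b
  induction w with
  | nil =>
    have h0 : ∀ n, 0 ≤ lastSum [] n := fun n => by
      rw [lastSum]
      split_ifs <;> norm_num
    intro n
    refine ⟨h0 n, by simp, trunc _ h0 n, ?_⟩
    rw [truncSum, Finset.sum_range_succ', Finset.sum_eq_zero fun k _ => by simp [lastSum]]
    simp [lastSum]
  | cons a w ih =>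
    have h0 : ∀ n, 0 ≤ lastSum (a :: w) n := by
      intro n
      cases a with
      | x => exact div_nonneg (ih n).1 (Nat.cast_nonneg n)
      | y => exact div_nonneg (ih n).2.2.1 (Nat.cast_nonneg n)
    have h1 : ∀ n, lastSum (a :: w) (n + 1) ≤ harm n ^ w.length / (n + 1 : ℝ) := by
      intro n
      have hL := one_le_harm n
      have hp : (0 : ℝ) < (n : ℝ) + 1 := by positivity
      cases a with
      | x =>
        rw [lastSum]
        push_cast
        refine div_le_div_of_nonneg_right ?_ hp.le
        cases w with
        | nil => simp [lastSum]
        | cons b w =>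
          refine ((ih n).2.1 b w rfl).trans ?_
          have h2 : harm n ^ w.length ≤ harm n ^ (b :: w).length :=
            pow_le_pow_right₀ hL (by simp)
          refine le_trans (div_le_self (by positivity) ?_) h2
          linarith [(Nat.cast_nonneg n : (0 : ℝ) ≤ n)]
      | y =>
        rw [lastSum]
        push_cast
        exact div_le_div_of_nonneg_right (ih n).2.2.2 hp.le
    intro n
    refine ⟨h0 n, ?_, trunc _ h0 n, ?_⟩
    · rintro a' w' h
      obtain ⟨rfl, rfl⟩ := List.cons.inj h
      exact h1 n
    · have hL := one_le_harm n
      rw [truncSum, Finset.sum_range_succ', lastSum_zero_of_cons, add_zero]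
      have h2 : ∀ k ∈ Finset.range n, lastSum (a :: w) (k + 1) ≤
          harm n ^ w.length * (1 / (k + 1 : ℝ)) := by
        intro k hk
        refine (h1 k).trans ?_
        rw [mul_one_div]
        exact div_le_div_of_nonneg_right (pow_le_pow_left₀ (by linarith [one_le_harm k])
          (harm_mono (Finset.mem_range.1 hk).le) _) (by positivity)
      refine (Finset.sum_le_sum h2).trans ?_
      rw [← Finset.mul_sum, List.length_cons, pow_succ]
      exact mul_le_mul_of_nonneg_left (sum_inv_le_harm le_rfl) (by positivity)

/-- The final x contributes one more factor 1/n than `lastSum_bounds`, so the terms are O(n^{-3/2}).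
-/
theorem summable_lastSum_x (w : List Letter) : Summable (lastSum (Letter.x :: w)) := by
  rw [← summable_nat_add_iff 1]
  cases w with
  | nil =>
    refine summable_zero.congr fun n => ?_
    simp [lastSum]
  | cons b w =>
    obtain ⟨C, hC, h⟩ := exists_harm_pow_le w.length
    have hs : Summable fun n : ℕ => C * (1 / ((n + 1 : ℕ) : ℝ) ^ (3 / 2 : ℝ)) :=
      ((summable_nat_add_iff 1).2 (Real.summable_one_div_nat_rpow.2 (by norm_num))).mul_left C
    refine Summable.of_nonneg_of_le (fun n => (lastSum_bounds _ _).1) (fun n => ?_) hs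
    have hp : (0 : ℝ) < (n : ℝ) + 1 := by positivity
    rw [lastSum]
    push_cast
    have h1 := (lastSum_bounds (b :: w) n).2.1 b w rfl
    have e : ((n : ℝ) + 1) ^ (3 / 2 : ℝ) * ((n : ℝ) + 1) ^ (1 / 2 : ℝ) =
        ((n : ℝ) + 1) * ((n : ℝ) + 1) := by
      rw [← Real.rpow_add hp]
      norm_num
      ring
    calc lastSum (b :: w) (n + 1) / ((n : ℝ) + 1)
        ≤ C * ((n : ℝ) + 1) ^ (1 / 2 : ℝ) / ((n : ℝ) + 1) / ((n : ℝ) + 1) :=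
          div_le_div_of_nonneg_right (h1.trans (div_le_div_of_nonneg_right (h n) hp.le)) hp.le
      _ = C * (1 / ((n : ℝ) + 1) ^ (3 / 2 : ℝ)) := by
          rw [div_div, ← e, mul_one_div, div_eq_div_iff (by positivity) (by positivity)]
          ring

/-- The tuples `0 < n₁ < ⋯ < n_r < N`. -/
def truncRange (r N : ℕ) : Finset (Fin r → ℕ) :=
  (Fintype.piFinset fun _ => Finset.range N).filter fun n => StrictMono n ∧ ∀ i, 0 < n i

theorem mem_truncRange {r N : ℕ} {n : Fin r → ℕ} :
    n ∈ truncRange r N ↔ (∀ i, n i < N) ∧ StrictMono n ∧ ∀ i, 0 < n i := by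
  simp [truncRange]

theorem strictMono_snoc {r : ℕ} {n : Fin r → ℕ} {p : ℕ} :
    StrictMono (Fin.snoc n p : Fin (r + 1) → ℕ) ↔ StrictMono n ∧ ∀ i, n i < p := by
  constructor
  · intro h
    refine ⟨fun i j hij => ?_, fun i => ?_⟩
    · simpa using h (Fin.castSucc_lt_castSucc_iff.2 hij)
    · simpa using h (Fin.castSucc_lt_last i)
  · rintro ⟨h, hp⟩ i j hij
    induction j using Fin.lastCases with
    | last =>
      induction i using Fin.lastCases with
      | last => exact absurd hij (lt_irrefl _)
      | cast i => simpa using hp i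
    | cast j =>
      induction i using Fin.lastCases with
      | last => exact absurd hij (not_lt.2 (Fin.le_last _))
      | cast i => simpa using h (Fin.castSucc_lt_castSucc_iff.1 hij)

theorem sum_truncRange_succ {r : ℕ} (f : (Fin (r + 1) → ℕ) → ℝ) (N : ℕ) :
    ∑ n ∈ truncRange (r + 1) N, f n =
      ∑ p ∈ (Finset.range N).filter (0 < ·), ∑ n ∈ truncRange r p, f (Fin.snoc n p) := by
  rw [Finset.sum_sigma']
  refine Finset.sum_bij' (fun n _ => ⟨n (Fin.last r), Fin.init n⟩)
    (fun q _ => Fin.snoc q.2 q.1) ?_ ?_ ?_ ?_ ?_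
  · intro n hn
    obtain ⟨h1, h2, h3⟩ := mem_truncRange.1 hn
    rw [← Fin.snoc_init_self n, strictMono_snoc] at h2
    simp only [Finset.mem_sigma, Finset.mem_filter, Finset.mem_range, mem_truncRange]
    exact ⟨⟨h1 _, h3 _⟩, h2.2, h2.1, fun i => h3 _⟩
  · rintro ⟨p, n⟩ hn
    simp only [Finset.mem_sigma, Finset.mem_filter, Finset.mem_range, mem_truncRange] at hn
    obtain ⟨⟨h1, h2⟩, h3, h4, h5⟩ := hn
    refine mem_truncRange.2 ⟨fun i => ?_, strictMono_snoc.2 ⟨h4, h3⟩, fun i => ?_⟩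
    · induction i using Fin.lastCases with
      | last => simpa using h1
      | cast i => simpa using (h3 i).trans h1
    · induction i using Fin.lastCases with
      | last => simpa using h2
      | cast i => simpa using h5 i
  · intro n _
    simp
  · rintro ⟨p, n⟩ _
    simp
  · intro n _
    simp

theorem lastSum_replicate_x (m : ℕ) (w : List Letter) (n : ℕ) :
    lastSum (List.replicate m Letter.x ++ w) n = lastSum w n / (n : ℝ) ^ m := by
  induction m with
  | zero => simp
  | succ m ih => rw [List.replicate_succ, List.cons_append, lastSum, ih, div_div, pow_succ]

theorem toList_eWord_append (k l : List ℕ) :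
    (eWord (k ++ l)).toList = (eWord k).toList ++ (eWord l).toList := by
  rw [eWord, List.map_append, List.prod_append, FreeMonoid.toList_mul]
  rfl

theorem reverse_eWord_append_singleton (k : List ℕ) (a : ℕ) :
    (eWord (k ++ [a])).toList.reverse =
      List.replicate (a - 1) Letter.x ++ Letter.y :: (eWord k).toList.reverse := by
  rw [toList_eWord_append, toList_eWord_cons]
  simp [eWord]

theorem truncSum_eWord_ofFn {r : ℕ} (K : Fin r → ℕ) (hK : ∀ i, 0 < K i) (N : ℕ) :
    truncSum (eWord (List.ofFn K)).toList.reverse (N + 1) =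
      ∑ n ∈ truncRange r (N + 1), ∏ i, 1 / (n i : ℝ) ^ K i := by
  induction r generalizing N with
  | zero =>
    have : truncRange 0 (N + 1) = {Fin.elim0} := by
      ext n
      simp only [mem_truncRange, Finset.mem_singleton]
      exact ⟨fun _ => funext fun i => i.elim0,
        fun _ => ⟨fun i => i.elim0, fun i => i.elim0, fun i => i.elim0⟩⟩
    rw [this, truncSum, Finset.sum_range_succ']
    simp [eWord, lastSum]
  | succ r ih =>
    rw [sum_truncRange_succ, List.ofFn_succ', List.concat_eq_append,
      reverse_eWord_append_singleton, truncSum, Finset.sum_filter]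
    refine Finset.sum_congr rfl fun p _ => ?_
    rw [lastSum_replicate_x, lastSum]
    rcases p with _ | p
    · simp
    · rw [if_pos p.succ_pos]
      have := ih (fun i => K i.castSucc) (fun i => hK _) p
      rw [truncSum] at this
      rw [this, div_div, ← pow_succ', Nat.sub_add_cancel (hK _), div_eq_mul_one_div,
        Finset.sum_mul]
      refine Finset.sum_congr rfl fun n _ => ?_
      rw [Fin.prod_univ_castSucc]
      simp

theorem mzvTerm_nonneg (k : List ℕ) (n : MZVRange k.length) : 0 ≤ mzvTerm k n :=
  Finset.prod_nonneg fun i _ => by positivity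

/-- The tuples of `MZVRange r` with entries below `N`. -/
def truncRangeSubtype (r N : ℕ) : Finset (MZVRange r) := (truncRange r N).subtype _

theorem mem_truncRangeSubtype {r N : ℕ} {n : MZVRange r} :
    n ∈ truncRangeSubtype r N ↔ ∀ i, n.1 i < N := by
  rw [truncRangeSubtype, Finset.mem_subtype, mem_truncRange]
  exact ⟨fun h => h.1, fun h => ⟨h, n.2⟩⟩

theorem sum_truncRangeSubtype (k : List ℕ) (hk : ∀ a ∈ k, 0 < a) (N : ℕ) :
    ∑ n ∈ truncRangeSubtype k.length (N + 1), mzvTerm k n =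
      truncSum (eWord k).toList.reverse (N + 1) := by
  have h := truncSum_eWord_ofFn k.get (fun i => hk _ (List.get_mem k i)) N
  rw [List.ofFn_get] at h
  rw [h]
  exact Finset.sum_subtype_of_mem (fun n => ∏ i, 1 / (n i : ℝ) ^ k.get i)
    fun n hn => (mem_truncRange.1 hn).2

open Filter Topology

theorem tendsto_truncRangeSubtype (r : ℕ) :
    Tendsto (fun N => truncRangeSubtype r (N + 1)) atTop atTop := by
  refine tendsto_atTop_finset_of_monotone (fun M N h n hn => ?_) fun n => ?_
  · rw [mem_truncRangeSubtype] at hn ⊢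
    exact fun i => (hn i).trans_le (by omega)
  · refine ⟨∑ i, n.1 i, mem_truncRangeSubtype.2 fun i => Nat.lt_succ_of_le ?_⟩
    exact Finset.single_le_sum (f := n.1) (fun _ _ => Nat.zero_le _) (Finset.mem_univ i)

theorem IsAdmissible.reverse_eWord {k : List ℕ} (hk : IsAdmissible k) :
    ∃ w, (eWord k).toList.reverse = Letter.x :: w := by
  obtain ⟨-, t, a, ha, rfl⟩ := hk
  refine ⟨List.replicate (a - 2) Letter.x ++ Letter.y :: (eWord t).toList.reverse, ?_⟩
  rw [reverse_eWord_append_singleton, show a - 1 = a - 2 + 1 by omega, List.replicate_succ,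
    List.cons_append]

/-- The terms are nonnegative, and grouping them by the largest entry reduces to the one-variable
series of `summable_lastSum_x`. -/
theorem summable_mzvTerm {k : List ℕ} (hk : IsAdmissible k) : Summable (mzvTerm k) := by
  obtain ⟨w, hw⟩ := hk.reverse_eWord
  have hs := summable_lastSum_x w
  refine summable_of_sum_le (c := ∑' n, lastSum (Letter.x :: w) n) (mzvTerm_nonneg k) fun u => ?_
  obtain ⟨N, hN⟩ := (tendsto_atTop.1 (tendsto_truncRangeSubtype k.length) u).exists
  refine (Finset.sum_le_sum_of_subset_of_nonneg hN fun n _ _ => mzvTerm_nonneg k n).trans ?_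
  rw [sum_truncRangeSubtype k hk.1, hw]
  exact hs.sum_le_tsum _ fun n _ => (lastSum_bounds _ n).1

theorem tendsto_truncSum_eWord {k : List ℕ} (hk : IsAdmissible k) :
    Tendsto (fun N => truncSum (eWord k).toList.reverse (N + 1)) atTop (𝓝 (mzv k)) := by
  have h := (summable_mzvTerm hk).hasSum.comp (tendsto_truncRangeSubtype k.length)
  refine h.congr fun N => ?_
  exact sum_truncRangeSubtype k hk.1 N


/-! ### Discretised integrals as functions of the block lengths. -/

/-- The letter of the last block of a word with `j` blocks, if the blocks alternate and the first
one consists of letters `y`. -/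
def blockLetter (j : ℕ) : Letter := if j % 2 = 1 then Letter.y else Letter.x

/-- The reversal of the word with alternating blocks, beginning with letters `y`, whose block
lengths are the reversal of `r`. -/
def revBlockWord : List ℕ → List Letter
  | [] => []
  | a :: t => List.replicate a (blockLetter (t.length + 1)) ++ revBlockWord t

/-- The discretised iterated integral in terms of the reversed list of block lengths. -/
noncomputable def blockSum (N : ℕ) (r : List ℕ) (m : ℕ) : ℝ :=
  if 0 ∈ r then 0 else weakSum N (revBlockWord r) m

/-- The indicator of `1`, as a real number. -/
noncomputable def isOne (a : ℕ) : ℝ := if a = 1 then 1 else 0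

theorem isOne_zero : isOne 0 = 0 := by simp [isOne]

theorem blockSum_of_mem {N : ℕ} {r : List ℕ} (h : 0 ∈ r) (m : ℕ) : blockSum N r m = 0 := if_pos h

theorem blockSum_zero_cons (N : ℕ) (r : List ℕ) (m : ℕ) : blockSum N (0 :: r) m = 0 :=
  blockSum_of_mem (by simp) m

theorem blockSum_cons_zero (N a : ℕ) (r : List ℕ) : blockSum N (a :: r) 0 = 0 := by
  rw [blockSum]
  split_ifs with h
  · rfl
  · obtain ⟨a, rfl⟩ : ∃ a', a = a' + 1 := ⟨a - 1, by simp at h; omega⟩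
    rw [revBlockWord, List.replicate_succ, List.cons_append, weakSum_zero_of_cons]

theorem blockSum_nil (N m : ℕ) : blockSum N [] m = 1 := by simp [blockSum, revBlockWord, weakSum]

/-- The increment consists of the chains whose top letter x sits at p = m+1; that letter is
stripped. Since a zero entry makes `blockSum` vanish, a block of length 1 leaves only the `isOne`
term, and the formula covers every `a`. -/
theorem blockSum_even_succ {N a : ℕ} {t : List ℕ} (ht : t.length % 2 = 1) (m : ℕ) :
    ((m : ℝ) + 1) * (blockSum N (a :: t) (m + 1) - blockSum N (a :: t) m) =
      blockSum N ((a - 1) :: t) (m + 1) + isOne a * blockSum N t (m + 1) := by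
  have hm : (m : ℝ) + 1 ≠ 0 := by positivity
  by_cases h0 : 0 ∈ t
  · simp [blockSum, h0]
  have hl : blockLetter (t.length + 1) = Letter.x := by
    rw [blockLetter, if_neg (by omega)]
  rcases a with _ | _ | a
  · simp [blockSum_zero_cons, isOne]
  · rw [Nat.zero_add, Nat.sub_self, blockSum_zero_cons]
    simp only [blockSum, List.mem_cons, h0, or_false, isOne, revBlockWord, hl,
      List.replicate_one, List.singleton_append, weakSum_x_succ, zero_ne_one, if_false, if_true]
    field_simp
    ring
  · rw [Nat.add_sub_cancel]
    simp only [blockSum, List.mem_cons, h0, or_false, isOne, revBlockWord, hl, weakSum_x_succ,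
      List.replicate_succ, List.cons_append, if_neg (Nat.succ_ne_zero _).symm]
    rw [if_neg (by omega), add_sub_cancel_left]
    field_simp
    simp

theorem head?_revBlockWord {t : List ℕ} (h0 : 0 ∉ t) (ht : t.length % 2 = 0) :
    (revBlockWord t).head? ≠ some Letter.y := by
  rcases t with _ | ⟨b, t⟩
  · simp [revBlockWord]
  · obtain ⟨b, rfl⟩ : ∃ b', b = b' + 1 := ⟨b - 1, by simp at h0; omega⟩
    have : blockLetter (t.length + 1) = Letter.x := by
      rw [blockLetter, if_neg (by simpa using ht)]
    simp [revBlockWord, List.replicate_succ, this]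

/-- The analogue for a top letter y. Inside the y-block the limit stays m+1, whereas the x-block
below is evaluated at `m`, since y lies strictly above x. -/
theorem blockSum_odd_succ {N a : ℕ} {t : List ℕ} (ht : t.length % 2 = 0) {m : ℕ} (hm : m + 1 < N) :
    ((N : ℝ) - (m + 1)) * (blockSum N (a :: t) (m + 1) - blockSum N (a :: t) m) =
      blockSum N ((a - 1) :: t) (m + 1) + isOne a * blockSum N t m := by
  have hm : (N : ℝ) - (m + 1) ≠ 0 := by
    have : ((m + 1 : ℕ) : ℝ) < N := by exact_mod_cast hm
    push_cast at this
    linarith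
  by_cases h0 : 0 ∈ t
  · simp [blockSum, h0]
  have hl : blockLetter (t.length + 1) = Letter.y := by
    rw [blockLetter, if_pos (by omega)]
  rcases a with _ | _ | a
  · simp [blockSum_zero_cons, isOne]
  · rw [Nat.zero_add, Nat.sub_self, blockSum_zero_cons]
    simp only [blockSum, List.mem_cons, h0, or_false, isOne, revBlockWord, hl,
      List.replicate_one, List.singleton_append, weakSum_y_succ, zero_ne_one, if_false, if_true,
      if_neg (head?_revBlockWord h0 ht)]
    field_simp
    ring
  · rw [Nat.add_sub_cancel]
    simp only [blockSum, List.mem_cons, h0, or_false, isOne, revBlockWord, hl,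
      List.replicate_succ, List.cons_append, if_neg (Nat.succ_ne_zero _).symm]
    rw [if_neg (by omega), weakSum_y_succ, if_pos (by simp), add_sub_cancel_left]
    field_simp
    simp

/-! ### The recurrence in N, proved for all upper limits at once. -/

/-- The operator on functions of a list that pairs the entries from the head on: in each pair at
most one entry is lowered by `1`, with weight `-q`, or both are deleted if they are equal to `1`,
with weight `q ^ 2`; an unpaired last entry may be lowered. -/
noncomputable def pairOp (q : ℝ) : List ℕ → (List ℕ → ℝ) → ℝ
  | [], f => f []
  | [a], f => f [a] - q * f [a - 1]
  | b :: a :: t, f => pairOp q t fun l => f (b :: a :: l) - q * f ((b - 1) :: a :: l) -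
      q * f (b :: (a - 1) :: l) + isOne b * isOne a * q ^ 2 * f l

/-- Entries are lowered in place or deleted in pairs, so `f` is evaluated only at lists whose length
has the parity of `t`. This is what allows the parity-dependent recurrences of `blockSum` to be used
under `pairOp`. -/
theorem pairOp_congr (q : ℝ) : ∀ (t : List ℕ) (f g : List ℕ → ℝ),
    (∀ l, l.length % 2 = t.length % 2 → f l = g l) → pairOp q t f = pairOp q t g
  | [], f, g, h => h [] rfl
  | [a], f, g, h => by rw [pairOp, pairOp, h [a] rfl, h [a - 1] rfl]
  | b :: a :: t, f, g, h => by
    rw [pairOp, pairOp]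
    refine pairOp_congr q t _ _ fun l hl => ?_
    have h2 : ∀ b a : ℕ, f (b :: a :: l) = g (b :: a :: l) := fun b a =>
      h _ (by simp only [List.length_cons]; omega)
    rw [h2, h2, h2, h l (by simp only [List.length_cons]; omega)]

theorem pairOp_add (q : ℝ) : ∀ (t : List ℕ) (f g : List ℕ → ℝ),
    pairOp q t (fun l => f l + g l) = pairOp q t f + pairOp q t g
  | [], f, g => rfl
  | [a], f, g => by simp only [pairOp]; ring
  | b :: a :: t, f, g => by
    simp only [pairOp]
    rw [← pairOp_add q t]
    congr 1
    funext l
    ring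

theorem pairOp_const_mul (q c : ℝ) : ∀ (t : List ℕ) (f : List ℕ → ℝ),
    pairOp q t (fun l => c * f l) = c * pairOp q t f
  | [], f => rfl
  | [a], f => by simp only [pairOp]; ring
  | b :: a :: t, f => by
    simp only [pairOp]
    rw [← pairOp_const_mul q c t]
    congr 1
    funext l
    ring

theorem pairOp_sub (q : ℝ) (t : List ℕ) (f g : List ℕ → ℝ) :
    pairOp q t (fun l => f l - g l) = pairOp q t f - pairOp q t g := by
  have h := pairOp_add q t f (fun l => -1 * g l)
  rw [pairOp_const_mul] at h
  rw [sub_eq_add_neg, ← neg_one_mul, ← h]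
  congr 1
  funext l
  ring

theorem pairOp_zero (q : ℝ) (t : List ℕ) : pairOp q t (fun _ => 0) = 0 := by
  simpa using pairOp_const_mul q 0 t fun _ => 0

/-- The transport relation for `t` a list of odd length. -/
def OddTransport (M : ℕ) (q : ℝ) : List ℕ → Prop
  | [] => True
  | a :: t => ∀ m ≤ M,
    pairOp q (a :: t) (fun l => blockSum (M + 2) l (m + 1)) =
      pairOp q t fun l =>
        blockSum (M + 1) (a :: l) m + q * isOne a * blockSum (M + 1) l m

/-- The transport relation for `a :: b :: t`, where `t` is a list of even length. -/
def EvenTransport (M : ℕ) (q : ℝ) (b : ℕ) (t : List ℕ) : Prop := ∀ a, ∀ m ≤ M,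
  pairOp q (b :: t) (fun l => blockSum (M + 2) (a :: l) m) =
    pairOp q t fun l =>
      blockSum (M + 1) (a :: b :: l) m -
        q * blockSum (M + 1) ((a - 1) :: b :: l) m -
        q * blockSum (M + 1) (a :: (b - 1) :: l) m -
        q * isOne a * blockSum (M + 1) (b :: l) m

/-- The weight 1/(N-p) of y is unchanged when N and p both grow by 1, while the weight 1/p of x does
not involve N. Hence the transport relations match the limits m+1 and m under a top y-block, and m
and m under a top x-block. The proofs use induction on the top block length and on `m`, comparing
increments after clearing the denominator. -/
theorem oddTransport_singleton {M : ℕ} {q : ℝ} (hqM : q * (M + 1) = 1) (a : ℕ) :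
    OddTransport M q [a] := by
  induction a with
  | zero =>
    intro m _
    simp [pairOp, blockSum_zero_cons, isOne]
  | succ a ih =>
    intro m
    have hrec' : ∀ b m, m ≤ M → ((M : ℝ) + 1 - m) *
        (blockSum (M + 2) [b] (m + 1) - blockSum (M + 2) [b] m) =
        blockSum (M + 2) [b - 1] (m + 1) + isOne b := by
      intro b m hm
      have := blockSum_odd_succ (N := M + 2) (a := b) (t := []) rfl (m := m) (by omega)
      rw [blockSum_nil, mul_one] at this
      rw [← this]
      push_cast
      ring
    have hrec : ∀ b m, m + 1 ≤ M → ((M : ℝ) + 1 - (m + 1)) *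
        (blockSum (M + 1) [b] (m + 1) - blockSum (M + 1) [b] m) =
        blockSum (M + 1) [b - 1] (m + 1) + isOne b := by
      intro b m hm
      have := blockSum_odd_succ (N := M + 1) (a := b) (t := []) rfl (m := m) (by omega)
      rw [blockSum_nil, mul_one] at this
      rw [← this]
      push_cast
      ring
    simp only [OddTransport, pairOp, blockSum_nil, Nat.add_sub_cancel, mul_one] at ih ⊢
    induction m with
    | zero =>
      intro _
      have h1 := hrec' (a + 1) 0 (Nat.zero_le _)
      rw [blockSum_cons_zero] at h1
      rw [blockSum_cons_zero]
      simp only [Nat.add_sub_cancel, Nat.cast_zero, sub_zero, zero_add] at h1 ⊢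
      linear_combination q * h1 - blockSum (M + 2) [a + 1] 1 * hqM
    | succ m ihm =>
      intro hm
      have hne : (M : ℝ) + 1 - (m + 1) ≠ 0 := by
        have : ((m + 1 : ℕ) : ℝ) ≤ M := by exact_mod_cast hm
        push_cast at this
        linarith
      have h0 := ihm (by omega)
      have h1 := hrec' (a + 1) (m + 1) hm
      have h2 := hrec' a (m + 1) hm
      have h3   := hrec (a + 1) m hm
      have h4 := ih (m + 1) hm
      push_cast at h1 h2
      rw [Nat.add_sub_cancel] at h3
      refine mul_left_cancel₀ hne ?_
      linear_combination h1 - q * h2 - h3 + ((M : ℝ) + 1 - (m + 1)) * h0 + h4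

/-- Stripping the last x of the top block exposes `b :: t` at the limit m+1, where the odd relation
applies. The factors m+1 and M-m of the x- and y-increments add up to M, plus 1, and the leftover is
absorbed by q(M+1) = 1. -/
theorem OddTransport.even {M b : ℕ} {q : ℝ} (hqM : q * (M + 1) = 1) {t : List ℕ}
    (ht : t.length % 2 = 0)
    (h : OddTransport M q (b :: t)) : EvenTransport M q b t := by
  intro a
  induction a with
  | zero =>
    intro m _
    simp [blockSum_zero_cons, isOne_zero, pairOp_zero]
  | succ a ih =>
    intro m
    rw [OddTransport] at h
    induction m with
    | zero =>
      intro _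
      simp [blockSum_cons_zero, pairOp_zero]
    | succ m ihm =>
      intro hm
      have hne : (m : ℝ) + 1 ≠ 0 := by positivity
      refine mul_left_cancel₀ hne ?_
      have h1 : ((m : ℝ) + 1) *
          pairOp q (b :: t) (fun l => blockSum (M + 2) ((a + 1) :: l) (m + 1)) =
          ((m : ℝ) + 1) * pairOp q (b :: t) (fun l => blockSum (M + 2) ((a + 1) :: l) m) +
          (pairOp q (b :: t) (fun l => blockSum (M + 2) (a :: l) (m + 1)) +
            isOne (a + 1) * pairOp q (b :: t) (fun l => blockSum (M + 2) l (m + 1))) := by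
        rw [← pairOp_const_mul, ← pairOp_const_mul, ← pairOp_const_mul, ← pairOp_add,
          ← pairOp_add]
        refine pairOp_congr _ _ _ _ fun l hl => ?_
        have := blockSum_even_succ (N := M + 2) (a := a + 1) (t := l)
          (by rw [hl, List.length_cons]; omega) m
        rw [Nat.add_sub_cancel] at this
        linear_combination this
      rw [h1, ihm (by omega), ih (m + 1) hm, h m (by omega), ← pairOp_const_mul,
        ← pairOp_const_mul, ← pairOp_const_mul, ← pairOp_add, ← pairOp_add]
      refine pairOp_congr _ _ _ _ fun l hl => ?_
      have hl' : l.length % 2 = 0 := by omega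
      have e : ∀ a c, _ := fun a c => blockSum_even_succ (N := M + 1) (a := a) (t := c :: l)
        (by rw [List.length_cons]; omega) m
      have e1 := e (a + 1) b
      have e2 := e a b
      have e3 := e (a + 1) (b - 1)
      have e4 := blockSum_odd_succ (N := M + 1) (a := b) hl' (m := m) (by omega)
      push_cast at e4
      simp only [Nat.add_sub_cancel] at e1 e2 e3 ⊢
      linear_combination -e1 + q * e2 + q * e3 - q * isOne (a + 1) * e4 +
        isOne (a + 1) * (blockSum (M + 1) (b :: l) (m + 1) - blockSum (M + 1) (b :: l) m) * hqM

theorem oddTransport_cons {M b c : ℕ} {q : ℝ} (hqM : q * (M + 1) = 1) {t : List ℕ}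
    (ht : t.length % 2 = 0) (h : OddTransport M q (c :: t)) (he : EvenTransport M q c t) (a : ℕ) :
    OddTransport M q (a :: b :: c :: t) := by
  induction a with
  | zero =>
    intro m _
    simp [pairOp, blockSum_zero_cons, isOne_zero, pairOp_zero]
  | succ a ih =>
    intro m
    rw [OddTransport] at h ih
    have hrec : ∀ a b m l, (l : List ℕ).length % 2 = 1 → m ≤ M → ((M : ℝ) + 1 - m) *
        (blockSum (M + 2) (a :: b :: l) (m + 1) - blockSum (M + 2) (a :: b :: l) m) =
        blockSum (M + 2) ((a - 1) :: b :: l) (m + 1) +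
          isOne a * blockSum (M + 2) (b :: l) m := by
      intro a b m l hl hm
      have := blockSum_odd_succ (N := M + 2) (a := a) (t := b :: l)
        (by rw [List.length_cons]; omega) (m := m) (by omega)
      rw [← this]
      push_cast
      ring
    simp only [pairOp, Nat.add_sub_cancel] at ih ⊢
    induction m with
    | zero =>
      intro _
      -- At upper limit 1 no y can lie strictly above an x, so only the double-deletion term of
      -- `pairOp` survives.
      have hz : ∀ a b l, (l : List ℕ).length % 2 = 1 →
          blockSum (M + 2) (a :: b :: l) (0 + 1) = 0 := by
        intro a b l hl
        induction a with
        | zero => rw [blockSum_zero_cons]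
        | succ a iha =>
          have h1 := hrec (a + 1) b 0 l hl (Nat.zero_le _)
          rw [blockSum_cons_zero, blockSum_cons_zero, Nat.add_sub_cancel, iha] at h1
          have : (M : ℝ) + 1 - (0 : ℕ) ≠ 0 := by
            rw [Nat.cast_zero, sub_zero]
            positivity
          simpa only [zero_add, mul_zero, add_zero, sub_zero, mul_eq_zero, this, false_or] using h1
      have h1 := pairOp_congr q (c :: t) (fun l => blockSum (M + 2) ((a + 1) :: b :: l) (0 + 1) -
          q * blockSum (M + 2) (a :: b :: l) (0 + 1) -
          q * blockSum (M + 2) ((a + 1) :: (b - 1) :: l) (0 + 1) +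
          isOne (a + 1) * isOne b * q ^ 2 * blockSum (M + 2) l (0 + 1))
        (fun l => isOne (a + 1) * isOne b * q ^ 2 * blockSum (M + 2) l (0 + 1)) (by
          intro l hl
          have hl' : l.length % 2 = 1 := by rw [hl, List.length_cons]; omega
          simp only [hz _ _ l hl']
          ring)
      rw [h1, pairOp_const_mul, h 0 (Nat.zero_le _), ← pairOp_const_mul]
      congr 1
      funext l
      simp only [blockSum_cons_zero]
      ring
    | succ m ihm =>
      intro hm
      have hne : (M : ℝ) + 1 - (m + 1) ≠ 0 := by
        have : ((m + 1 : ℕ) : ℝ) ≤ M := by exact_mod_cast hm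
        push_cast at this
        linarith
      refine mul_left_cancel₀ hne ?_
      -- The increment in the limit, with the double-deletion terms added and subtracted. This
      -- completes the expressions for the limit m+1 and for the block length `a`, to which `ihm`
      -- and `ih` apply.
      have h1 : ((M : ℝ) + 1 - (m + 1)) * pairOp q (c :: t) (fun l =>
            blockSum (M + 2) ((a + 1) :: b :: l) (m + 1 + 1) -
            q * blockSum (M + 2) (a :: b :: l) (m + 1 + 1) -
            q * blockSum (M + 2) ((a + 1) :: (b - 1) :: l) (m + 1 + 1) +
            isOne (a + 1) * isOne b * q ^ 2 * blockSum (M + 2) l (m + 1 + 1)) =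
          ((M : ℝ) + 1 - (m + 1)) * pairOp q (c :: t) (fun l =>
            blockSum (M + 2) ((a + 1) :: b :: l) (m + 1) -
            q * blockSum (M + 2) (a :: b :: l) (m + 1) -
            q * blockSum (M + 2) ((a + 1) :: (b - 1) :: l) (m + 1) +
            isOne (a + 1) * isOne b * q ^ 2 * blockSum (M + 2) l (m + 1)) +
          pairOp q (c :: t) (fun l =>
            blockSum (M + 2) (a :: b :: l) (m + 1 + 1) -
            q * blockSum (M + 2) ((a - 1) :: b :: l) (m + 1 + 1) -
            q * blockSum (M + 2) (a :: (b - 1) :: l) (m + 1 + 1) +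
            isOne a * isOne b * q ^ 2 * blockSum (M + 2) l (m + 1 + 1)) -
          isOne a * isOne b * q ^ 2 *
            pairOp q (c :: t) (fun l => blockSum (M + 2) l (m + 1 + 1)) +
          isOne (a + 1) * pairOp q (c :: t) (fun l => blockSum (M + 2) (b :: l) (m + 1)) -
          isOne (a + 1) * q * pairOp q (c :: t) (fun l => blockSum (M + 2) ((b - 1) :: l) (m + 1)) -
          isOne a * q * pairOp q (c :: t) (fun l => blockSum (M + 2) (b :: l) (m + 1)) +
          isOne (a + 1) * isOne b * q ^ 2 * ((M : ℝ) + 1 - (m + 1)) *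
            pairOp q (c :: t) (fun l => blockSum (M + 2) l (m + 1 + 1)) -
          isOne (a + 1) * isOne b * q ^ 2 * ((M : ℝ) + 1 - (m + 1)) *
            pairOp q (c :: t) (fun l => blockSum (M + 2) l (m + 1)) := by
        repeat rw [← pairOp_const_mul]
        repeat first | rw [← pairOp_sub] | rw [← pairOp_add]
        refine pairOp_congr _ _ _ _ fun l hl => ?_
        have hl' : l.length % 2 = 1 := by rw [hl, List.length_cons]; omega
        have e1 := hrec (a + 1) b (m + 1) l hl' hm
        have e2 := hrec a b (m + 1) l hl' hm
        have e3 := hrec (a + 1) (b - 1) (m + 1) l hl' hm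
        push_cast at e1 e2 e3
        linear_combination e1 - q * e2 - q * e3
      rw [h1, ihm (by omega), ih (m + 1) hm, h (m + 1) hm, h m (by omega), he b (m + 1) hm,
        he (b - 1) (m + 1) hm]
      repeat rw [← pairOp_const_mul]
      repeat first | rw [← pairOp_sub] | rw [← pairOp_add]
      refine pairOp_congr _ _ _ _ fun l hl => ?_
      have hl' : l.length % 2 = 0 := by omega
      have o : ∀ a t, (t : List ℕ).length % 2 = 0 → _ := fun a t h =>
        blockSum_odd_succ (N := M + 1) (a := a) (t := t) h (m := m) (by omega)
      have e : ∀ a c, _ := fun a c => blockSum_even_succ (N := M + 1) (a := a) (t := c :: l)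
        (by rw [List.length_cons]; omega) m
      have o1 := o (a + 1) (b :: c :: l) (by simp only [List.length_cons]; omega)
      have o2 := o (a + 1) ((b - 1) :: c :: l) (by simp only [List.length_cons]; omega)
      have o3 := o (a + 1) (b :: (c - 1) :: l) (by simp only [List.length_cons]; omega)
      have o4 := o (a + 1) l hl'
      have o5 := o c l hl'
      have e1 := e b c
      have e2 := e (b - 1) c
      have e3 := e b (c - 1)
      push_cast at o1 o2 o3 o4 o5
      linear_combination -o1 + q * o2 + q * o3 - isOne b * isOne c * q ^ 2 * o4 +
        isOne (a + 1) * q * e1 - isOne (a + 1) * q ^ 2 * e2 - isOne (a + 1) * q ^ 2 * e3 +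
        isOne (a + 1) * isOne b * q ^ 2 * o5 + isOne (a + 1) *
          (-(blockSum (M + 1) (b :: c :: l) (m + 1) - blockSum (M + 1) (b :: c :: l) m) +
          q * (blockSum (M + 1) ((b - 1) :: c :: l) (m + 1) -
            blockSum (M + 1) ((b - 1) :: c :: l) m) +
          q * (blockSum (M + 1) (b :: (c - 1) :: l) (m + 1) -
            blockSum (M + 1) (b :: (c - 1) :: l) m)) * hqM

theorem oddTransport {M : ℕ} {q : ℝ} (hqM : q * (M + 1) = 1) : ∀ t : List ℕ,
    t.length % 2 = 1 → OddTransport M q t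
  | [], h => by simp at h
  | [a], _ => oddTransport_singleton hqM a
  | [_, _], h => by simp at h
  | a :: b :: c :: t, h => by
    have ht : t.length % 2 = 0 := by simp only [List.length_cons] at h; omega
    have h1 := oddTransport hqM (c :: t) (by simp only [List.length_cons]; omega)
    exact oddTransport_cons hqM ht h1 (h1.even hqM ht) a

/-- The recurrence in `N` of the discretised iterated integrals. -/
theorem blockSum_transport {M : ℕ} {q : ℝ} (hqM : q * (M + 1) = 1) (a b : ℕ) {t : List ℕ}
    (ht : t.length % 2 = 0) :
    pairOp q (b :: t) (fun l => blockSum (M + 2) (a :: l) (M + 1) -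
      q * blockSum (M + 2) ((a - 1) :: l) (M + 1)) =
    pairOp q (a :: b :: t) fun l => blockSum (M + 1) l M := by
  have ho := oddTransport hqM (b :: t) (by rw [List.length_cons]; omega)
  -- A letter x at the topmost position p = M+1 has weight exactly `q`. Lowering the top block
  -- therefore cancels the chains that use this position, except those where the x-block has length
  -- 1.
  have h1 : pairOp q (b :: t) (fun l => blockSum (M + 2) (a :: l) (M + 1) -
        q * blockSum (M + 2) ((a - 1) :: l) (M + 1)) =
      pairOp q (b :: t) (fun l => blockSum (M + 2) (a :: l) M) +
        q * isOne a * pairOp q (b :: t) (fun l => blockSum (M + 2) l (M + 1)) := by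
    rw [← pairOp_const_mul, ← pairOp_add]
    refine pairOp_congr _ _ _ _ fun l hl => ?_
    have := blockSum_even_succ (N := M + 2) (a := a) (t := l)
      (by rw [hl, List.length_cons]; omega) M
    linear_combination q * this -
      (blockSum (M + 2) (a :: l) (M + 1) - blockSum (M + 2) (a :: l) M) * hqM
  rw [h1, ho.even hqM ht a M le_rfl, ho M le_rfl, ← pairOp_const_mul, ← pairOp_add, pairOp]
  congr 1
  funext l
  ring


/-! ### From the pairing operator to sums over pairs (A, B). -/

/-- `A` is a union of pairs `{i, i + 1}` with `i` of parity `e`, and `B` contains no such pair. -/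
def PairCompatible (e : ℕ) (A B : Finset ℕ) : Prop :=
  ∀ i, i % 2 = e → (i ∈ A ↔ i + 1 ∈ A) ∧ ¬(i ∈ B ∧ i + 1 ∈ B)

open Classical in
/-- The indicator of `PairCompatible`. -/
noncomputable def compat (e : ℕ) (A B : Finset ℕ) : ℝ := if PairCompatible e A B then 1 else 0

theorem compat_congr {e : ℕ} {A B A' B' : Finset ℕ}
    (h : PairCompatible e A B ↔ PairCompatible e A' B') : compat e A B = compat e A' B' := by
  by_cases h' : PairCompatible e A' B'
  · rw [compat, compat, if_pos h', if_pos (h.2 h')]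
  · rw [compat, compat, if_neg h', if_neg fun hg => h' (h.1 hg)]

theorem compat_eq_zero {e : ℕ} {A B : Finset ℕ} (h : ¬PairCompatible e A B) : compat e A B = 0 :=
  if_neg h

/-- The signed sum of `q ^ (#A + #B) f(c_{(-A)} - δ_B)` over the compatible pairs `(A, B)`. -/
noncomputable def pairSum (q : ℝ) (e : ℕ) (c : List ℕ) (f : List ℕ → ℝ) : ℝ :=
  ∑ A ∈ (onePos c).powerset, ∑ B ∈ (bigPos c).powerset,
    compat e A B * ((-1 : ℝ) ^ B.card * q ^ (A.card + B.card) * f (reduce c A B))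

theorem mem_positions_of_subset_onePos {c : List ℕ} {A : Finset ℕ} (hA : A ⊆ onePos c) {i : ℕ}
    (hi : i ∈ A) : 1 ≤ i ∧ i ≤ c.length :=
  Finset.mem_Icc.1 (Finset.mem_filter.1 (hA hi)).1

theorem mem_positions_of_subset_bigPos {c : List ℕ} {A : Finset ℕ} (hA : A ⊆ bigPos c) {i : ℕ}
    (hi : i ∈ A) : 1 ≤ i ∧ i ≤ c.length :=
  Finset.mem_Icc.1 (Finset.mem_filter.1 (hA hi)).1

theorem entry_append_of_le {t : List ℕ} {i : ℕ} (a : ℕ) (h1 : 1 ≤ i) (h2 : i ≤ t.length) :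
    entry (t ++ [a]) i = entry t i := by
  rw [entry, entry, List.getD_append _ _ _ _ (by omega)]

theorem entry_append_length (t : List ℕ) (a : ℕ) : entry (t ++ [a]) (t.length + 1) = a := by
  simp [entry]

theorem filter_positions_append (t : List ℕ) (a : ℕ) (p : ℕ → Prop) [DecidablePred p] :
    ((positions (t ++ [a])).filter fun i => p (entry (t ++ [a]) i)) =
      if p a then insert (t.length + 1) ((positions t).filter fun i => p (entry t i))
      else (positions t).filter fun i => p (entry t i) := by
  have h : positions (t ++ [a]) = insert (t.length + 1) (positions t) := by
    ext i
    simp only [positions, List.length_append, List.length_singleton, Finset.mem_Icc,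
      Finset.mem_insert]
    omega
  have h2 : (positions t).filter (fun i => p (entry (t ++ [a]) i)) =
      (positions t).filter fun i => p (entry t i) := by
    refine Finset.filter_congr fun i hi => ?_
    obtain ⟨h1, h2⟩ := Finset.mem_Icc.1 hi
    rw [entry_append_of_le a h1 h2]
  rw [h, Finset.filter_insert, entry_append_length, h2]

theorem notMem_positions (t : List ℕ) : t.length + 1 ∉ positions t := by
  simp [positions]

/-- The new last position may join only A if its entry is 1, only B if it is larger, and neither if
it is 0. -/
theorem sum_onePos_bigPos_append (t : List ℕ) (a : ℕ) (F : Finset ℕ → Finset ℕ → ℝ) :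
    ∑ A ∈ (onePos (t ++ [a])).powerset, ∑ B ∈ (bigPos (t ++ [a])).powerset, F A B =
      ∑ A ∈ (onePos t).powerset, ∑ B ∈ (bigPos t).powerset, (F A B +
        (if a = 1 then F (insert (t.length + 1) A) B else 0) +
        (if 1 < a then F A (insert (t.length + 1) B) else 0)) := by
  have hO : t.length + 1 ∉ onePos t := fun h => notMem_positions t (Finset.mem_filter.1 h).1
  have hB : t.length + 1 ∉ bigPos t := fun h => notMem_positions t (Finset.mem_filter.1 h).1
  have e1 : onePos (t ++ [a]) = if a = 1 then insert (t.length + 1) (onePos t) else onePos t :=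
    filter_positions_append t a (· = 1)
  have e2 : bigPos (t ++ [a]) = if 1 < a then insert (t.length + 1) (bigPos t) else bigPos t :=
    filter_positions_append t a (1 < ·)
  rw [e1, e2]
  by_cases h1 : a = 1
  · subst h1
    simp [Finset.sum_powerset_insert hO, Finset.sum_add_distrib]
  · by_cases h2 : 1 < a
    · simp [h1, h2, Finset.sum_powerset_insert hB, Finset.sum_add_distrib]
    · simp [h1, h2]

theorem reduce_congr {t : List ℕ} {A A' B B' : Finset ℕ}
    (hA : ∀ i, i ≤ t.length → (i ∈ A ↔ i ∈ A')) (hB : ∀ i, i ≤ t.length → (i ∈ B ↔ i ∈ B')) :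
    reduce t A B = reduce t A' B' := by
  have h : (List.range' 1 t.length).filter (· ∉ A) =
      (List.range' 1 t.length).filter (· ∉ A') := by
    refine List.filter_congr fun i hi => ?_
    rw [List.mem_range'_1] at hi
    simp [hA i (by omega)]
  rw [reduce, reduce, h]
  refine List.map_congr_left fun i hi => ?_
  have hi' := List.mem_range'_1.1 (List.mem_filter.1 hi).1
  simp [hB i (by omega)]

theorem reduce_append (t : List ℕ) (a : ℕ) (A B : Finset ℕ) :
    reduce (t ++ [a]) A B = reduce t A B ++
      if t.length + 1 ∈ A then [] else [a - if t.length + 1 ∈ B then 1 else 0] := by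
  have h : List.map (fun i => entry (t ++ [a]) i - if i ∈ B then 1 else 0)
      ((List.range' 1 t.length).filter (· ∉ A)) = reduce t A B := by
    refine List.map_congr_left fun i hi => ?_
    have hi' := List.mem_range'_1.1 (List.mem_filter.1 hi).1
    rw [entry_append_of_le a hi'.1 (by omega)]
  rw [reduce, List.length_append, List.length_singleton, List.range'_concat, List.filter_append,
    List.map_append, h, Nat.one_mul, Nat.add_comm 1]
  congr 1
  by_cases hA : t.length + 1 ∈ A
  · simp [hA]
  · simp [hA, entry_append_length]

theorem reduce_nil (A B : Finset ℕ) : reduce [] A B = [] := rfl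

/-- For functions that vanish on lists containing 0, the restriction c_i > 1 on B is automatic. -/
theorem ite_one_lt_mul_eq {f : ℕ → ℝ} (hf : f 0 = 0) (a : ℕ) :
    (if 1 < a then f (a - 1) else 0) = f (a - 1) := by
  split_ifs with h
  · rfl
  · rw [show a - 1 = 0 by omega, hf]

theorem pairSum_nil (q : ℝ) (e : ℕ) (f : List ℕ → ℝ) : pairSum q e [] f = f [] := by
  simp [pairSum, onePos, bigPos, positions, compat, PairCompatible, reduce_nil]

/-- The partner of the last position lies outside the list: beyond its end, or at the fictitious
position 0. The last entry can therefore be lowered but never deleted. -/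
theorem pairSum_append_unpaired (q : ℝ) {e : ℕ} {t : List ℕ} (a : ℕ) {f : List ℕ → ℝ}
    (hf : ∀ l, 0 ∈ l → f l = 0) (h : (t.length + 1) % 2 = e ∨ t = [] ∧ e = 0) :
    pairSum q e (t ++ [a]) f = pairSum q e t fun l => f (l ++ [a]) - q * f (l ++ [a - 1]) := by
  rw [pairSum, sum_onePos_bigPos_append, pairSum]
  refine Finset.sum_congr rfl fun A hA => Finset.sum_congr rfl fun B hB => ?_
  rw [Finset.mem_powerset] at hA hB
  have hA' : ∀ i, (i = 0 ∨ t.length < i) → i ∉ A := fun i h hi => by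
    have := mem_positions_of_subset_onePos hA hi; omega
  have hB' : ∀ i, (i = 0 ∨ t.length < i) → i ∉ B := fun i h hi => by
    have := mem_positions_of_subset_bigPos hB hi; omega
  have nA : t.length + 1 ∉ A := hA' _ (by omega)
  have nB : t.length + 1 ∉ B := hB' _ (by omega)
  have g1 : compat e (insert (t.length + 1) A) B = 0 := by
    refine compat_eq_zero fun hg => ?_
    rcases h with h | ⟨rfl, rfl⟩
    · have := (hg _ h).1.1 (by simp)
      simp [hA' (t.length + 1 + 1) (by omega)] at this
    · have := (hg 0 rfl).1.2 (by simp)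
      simp [hA' 0 (by omega)] at this
  have g2 : compat e A (insert (t.length + 1) B) = compat e A B := by
    refine compat_congr (forall_congr' fun i => imp_congr_right fun hi =>
      and_congr_right fun _ => not_congr ?_)
    simp only [Finset.mem_insert]
    rcases h with h | ⟨rfl, rfl⟩
    · have h1 : i + 1 ≠ t.length + 1 := by omega
      rcases eq_or_ne i (t.length + 1) with rfl | h2
      · simp [hB' (t.length + 1 + 1) (by omega)]
      · simp only [h1, h2, false_or]
    · simp only [List.length_nil]
      rcases eq_or_ne i 0 with rfl | h2
      · simp [hB' 0 (by omega)]
      · have : i ≠ 0 + 1 := by rintro rfl; omega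
        have : i + 1 ≠ 0 + 1 := by omega
        simp [*]
  have r1 : reduce t A (insert (t.length + 1) B) = reduce t A B :=
    reduce_congr (fun i _ => Iff.rfl) fun i hi => by simp; omega
  have h0 : f (reduce t A B ++ [0]) = 0 := hf _ (by simp)
  have := ite_one_lt_mul_eq (f := fun k => f (reduce t A B ++ [k])) h0 a
  simp only [g1, g2, zero_mul, ite_self, add_zero]
  rw [← this]
  simp only [reduce_append, nA, nB, r1, Finset.card_insert_of_notMem nB,
    Finset.mem_insert_self, if_true, if_false, Nat.sub_zero]
  split_ifs <;> ring

/-- Compatibility is a condition on each pair separately, so the last pair factors out. -/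
theorem compat_union {e n : ℕ} {A B A0 B0 : Finset ℕ} (h : (n + 1) % 2 = e)
    (hA : ∀ i ∈ A, i ≤ n) (hB : ∀ i ∈ B, i ≤ n)
    (hA0 : A0 ⊆ {n + 1, n + 2}) (hB0 : B0 ⊆ {n + 1, n + 2}) :
    compat e (A0 ∪ A) (B0 ∪ B) =
      if (n + 1 ∈ A0 ↔ n + 2 ∈ A0) ∧ ¬(n + 1 ∈ B0 ∧ n + 2 ∈ B0) then compat e A B else 0 := by
  have small : ∀ i, i ≤ n → i ∉ A0 ∧ i ∉ B0 := fun i hi =>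
    ⟨fun hh => by have := hA0 hh; simp at this; omega,
      fun hh => by have := hB0 hh; simp at this; omega⟩
  have large : ∀ i, n < i → i ∉ A ∧ i ∉ B := fun i hi =>
    ⟨fun hh => by have := hA i hh; omega, fun hh => by have := hB i hh; omega⟩
  have nn1 := large (n + 1) (by omega)
  have nn2 := large (n + 2) (by omega)
  have top : (n + 1 ∈ A0 ∪ A ↔ n + 1 + 1 ∈ A0 ∪ A) ∧ ¬(n + 1 ∈ B0 ∪ B ∧ n + 1 + 1 ∈ B0 ∪ B) ↔
      (n + 1 ∈ A0 ↔ n + 2 ∈ A0) ∧ ¬(n + 1 ∈ B0 ∧ n + 2 ∈ B0) := by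
    simp only [Finset.mem_union, nn1, nn2, or_false]
  split_ifs with hc
  · refine compat_congr (forall_congr' fun i => imp_congr_right fun hi => ?_)
    rcases le_or_gt i n with h1 | h1
    · simp only [Finset.mem_union, small i h1, small (i + 1) (by omega), false_or]
    · rcases eq_or_ne i (n + 1) with rfl | h2
      · rw [top]
        simp only [hc, nn1, large (n + 1 + 1) (by omega)]
        simp
      · have a1 : ∀ j, n + 2 < j → j ∉ A0 ∧ j ∉ B0 := fun j hj =>
          ⟨fun hh => by have := hA0 hh; simp at this; omega,
            fun hh => by have := hB0 hh; simp at this; omega⟩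
        simp only [Finset.mem_union, a1 i (by omega), a1 (i + 1) (by omega), false_or]
  · exact compat_eq_zero fun hg => hc (top.1 (hg _ h))

/-- Four choices on the last pair are compatible: leave it, lower either entry, or delete both.
These are the four terms of `pairOp`. -/
theorem pairSum_append_pair (q : ℝ) {e : ℕ} {t : List ℕ} (a b : ℕ) {f : List ℕ → ℝ}
    (hf : ∀ l, 0 ∈ l → f l = 0) (h : (t.length + 1) % 2 = e) :
    pairSum q e (t ++ [a] ++ [b]) f = pairSum q e t fun l =>
      f (l ++ [a] ++ [b]) - q * f (l ++ [a] ++ [b - 1]) - q * f (l ++ [a - 1] ++ [b]) +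
        isOne b * isOne a * q ^ 2 * f l := by
  rw [pairSum, sum_onePos_bigPos_append, sum_onePos_bigPos_append, pairSum]
  refine Finset.sum_congr rfl fun A hA => Finset.sum_congr rfl fun B hB => ?_
  rw [Finset.mem_powerset] at hA hB
  have hA' := fun i hi => (mem_positions_of_subset_onePos hA (i := i) hi).2
  have hB' := fun i hi => (mem_positions_of_subset_bigPos hB (i := i) hi).2
  have l1 : (t ++ [a]).length + 1 = t.length + 2 := by simp
  rw [l1]
  have r : ∀ A1 B1 : Finset ℕ, A1 ⊆ {t.length + 1, t.length + 2} →
      B1 ⊆ {t.length + 1, t.length + 2} → reduce t (A1 ∪ A) (B1 ∪ B) = reduce t A B := by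
    intro A1 B1 h1 h2
    refine reduce_congr (fun i hi => ?_) fun i hi => ?_ <;>
      simp only [Finset.mem_union, or_iff_right_iff_imp] <;> intro hh
    · have := h1 hh
      simp at this
      omega
    · have := h2 hh
      simp at this
      omega
  generalize hn : t.length = n at *
  have nA1 : n + 1 ∉ A := fun hi => by have := hA' _ hi; omega
  have nA2 : n + 2 ∉ A := fun hi => by have := hA' _ hi; omega
  have nB1 : n + 1 ∉ B := fun hi => by have := hB' _ hi; omega
  have nB2 : n + 2 ∉ B := fun hi => by have := hB' _ hi; omega
  have key := fun A0 B0 => compat_union (A0 := A0) (B0 := B0) h hA' hB'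
  have k10 := key {n + 1} ∅ (by simp) (by simp)
  have k20 := key {n + 2} ∅ (by simp) (by simp)
  have k30 := key {n + 2, n + 1} ∅ (by simp [Finset.pair_comm]) (by simp)
  have k01 := key ∅ {n + 1} (by simp) (by simp)
  have k02 := key ∅ {n + 2} (by simp) (by simp)
  have k03 := key ∅ {n + 2, n + 1} (by simp) (by simp [Finset.pair_comm])
  have k12 := key {n + 1} {n + 2} (by simp) (by simp)
  have k21 := key {n + 2} {n + 1} (by simp) (by simp)
  have r01 := r ∅ {n + 1} (by simp) (by simp)
  have r02 := r ∅ {n + 2} (by simp) (by simp)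
  have r30 := r {n + 2, n + 1} ∅ (by simp [Finset.pair_comm]) (by simp)
  simp only [Finset.empty_union, Finset.singleton_union, Finset.insert_union,
    Finset.mem_singleton, Finset.mem_insert, Finset.notMem_empty]
    at k10 k20 k30 k01 k02 k03 k12 k21 r01 r02 r30
  simp at k10 k20 k30 k01 k02 k03 k12 k21
  have nB3 : n + 2 ∉ insert (n + 1) B := by simp [nB2]
  have nA3 : n + 2 ∉ insert (n + 1) A := by simp [nA2]
  have hb : ∀ l, f (l ++ [0]) = 0 := fun l => hf _ (by simp)
  have ha : ∀ l, f (l ++ [0] ++ [b]) = 0 := fun l => hf _ (by simp)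
  have e1 := ite_one_lt_mul_eq (f := fun k => f (reduce t A B ++ [a] ++ [k])) (hb _) b
  have e2 := ite_one_lt_mul_eq (f := fun k => f (reduce t A B ++ [k] ++ [b])) (ha _) a
  simp only [k10, k20, k30, k01, k02, k03, k12, k21, zero_mul, ite_self, add_zero, zero_add]
  rw [← e1, ← e2]
  simp only [reduce_append, l1, hn, nA1, nA2, nB1, nB2, r01, r02, r30,
    Finset.card_insert_of_notMem nB1, Finset.card_insert_of_notMem nB2,
    Finset.card_insert_of_notMem nA3, Finset.card_insert_of_notMem nA1, Finset.mem_insert,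
    if_false, Nat.sub_zero, isOne]
  simp
  split_ifs <;> first | omega | ring

/-- The parity condition makes the last two positions a pair, so pairs can be removed from the end;
for odd length the first position remains, unpaired. -/
theorem pairSum_eq_pairOp (q : ℝ) (e : ℕ) : ∀ (n : ℕ) (c : List ℕ) (f : List ℕ → ℝ),
    c.length = n → (n + 1) % 2 = e → (∀ l, 0 ∈ l → f l = 0) →
    pairSum q e c f = pairOp q c.reverse fun l => f l.reverse := by
  intro n
  induction n using Nat.strong_induction_on with
  | _ n ih =>
  intro c f hc he hf
  rcases c.eq_nil_or_concat' with rfl | ⟨t, b, rfl⟩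
  · rw [pairSum_nil]
    rfl
  rcases t.eq_nil_or_concat' with rfl | ⟨t, a, rfl⟩
  · rw [pairSum_append_unpaired q b hf (Or.inr ⟨rfl, by simp at hc; omega⟩), pairSum_nil]
    simp [pairOp]
  · simp only [List.length_append, List.length_singleton] at hc
    rw [pairSum_append_pair q a b hf (by omega), ih t.length (by omega) t _ rfl (by omega)]
    · simp [pairOp]
    · intro l hl
      rw [hf _ (by simp [hl]), hf _ (by simp [hl]), hf _ (by simp [hl]), hf _ hl]
      simp

/-- The recurrence in `N` of the discretised iterated integrals, as an identity between sums over
pairs `(A, B)`. -/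
theorem pairSum_blockSum {M : ℕ} {q : ℝ} (hqM : q * (M + 1) = 1) {c : List ℕ} {s : ℕ}
    (hs : 0 < s) (hc : c.length = 2 * s) :
    pairSum q 0 c (fun l => blockSum (M + 2) l.reverse (M + 1)) =
      pairSum q 1 c fun l => blockSum (M + 1) l.reverse M := by
  have h0 : ∀ N m l, 0 ∈ l → blockSum N (l : List ℕ).reverse m = 0 := fun N m l hl =>
    blockSum_of_mem (by simpa using hl) m
  rcases c.eq_nil_or_concat' with rfl | ⟨t, b, rfl⟩
  · simp at hc
    omega
  rcases t.eq_nil_or_concat' with rfl | ⟨t, a, rfl⟩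
  · simp at hc
    omega
  simp only [List.length_append, List.length_singleton] at hc
  -- The odd-even pairs exhaust the positions. For the even-odd pairs the last position is unpaired
  -- and is split off before pairing the rest.
  rw [pairSum_eq_pairOp q 1 _ _ _ rfl (by simp; omega) (h0 _ _),
    pairSum_append_unpaired q b (h0 _ _) (Or.inl (by simp; omega)),
    pairSum_eq_pairOp q 0 _ _ _ rfl (by simp; omega)]
  · have := blockSum_transport hqM b a (t := t.reverse) (by simp; omega)
    simpa using this
  · intro l hl
    rw [h0 _ _ _ (by simp [hl]), h0 _ _ _ (by simp [hl])]
    simp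


/-! ### Truncated evaluation of 𝔇. -/

theorem hoffman_induction {p : H → Prop} (a : H) (zero : p 0)
    (add : ∀ a b, p a → p b → p (a + b)) (smul : ∀ (r : ℚ) w, p (r • ofWord w)) : p a := by
  induction a using MonoidAlgebra.induction_linear with
  | zero => exact zero
  | add a b ha hb => exact add a b ha hb
  | single w r =>
    have : MonoidAlgebra.single w r = r • ofWord w := by simp [ofWord]
    rw [this]
    exact smul r w

theorem linearMap_ext {V : Type} [AddCommGroup V] [Module ℚ V] {φ ψ : H →ₗ[ℚ] V}
    (h : ∀ w, φ (ofWord w) = ψ (ofWord w)) (a : H) : φ a = ψ a := by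
  induction a using hoffman_induction with
  | zero => rw [map_zero, map_zero]
  | add a b ha hb => rw [map_add, map_add, ha, hb]
  | smul r w => rw [map_smul, map_smul, h]

/-- The linear extension of `lastSum`. -/
noncomputable def lastEval (n : ℕ) : H →ₗ[ℚ] ℝ := wordLift fun w => lastSum w.toList.reverse n

/-- The linear extension of truncated multiple zeta values. -/
noncomputable def truncEval (N : ℕ) : H →ₗ[ℚ] ℝ := wordLift fun w => truncSum w.toList.reverse N

theorem lastEval_ofWord (n : ℕ) (w : Word) : lastEval n (ofWord w) = lastSum w.toList.reverse n :=
  wordLift_ofWord _ w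

theorem truncEval_ofWord (n : ℕ) (w : Word) :
    truncEval n (ofWord w) = truncSum w.toList.reverse n :=
  wordLift_ofWord _ w

theorem truncEval_succ (N : ℕ) (a : H) :
    truncEval (N + 1) a = truncEval N a + lastEval N a := by
  refine linearMap_ext (φ := truncEval (N + 1)) (ψ := truncEval N + lastEval N) (fun w => ?_) a
  rw [LinearMap.add_apply, truncEval_ofWord, truncEval_ofWord, lastEval_ofWord, truncSum,
    Finset.sum_range_succ, truncSum]

theorem lastEval_mul_X (n : ℕ) (a : H) : lastEval n (a * X) = 1 / (n : ℝ) * lastEval n a := by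
  induction a using hoffman_induction with
  | zero => simp
  | add a b ha hb => rw [add_mul, map_add, map_add, ha, hb, mul_add]
  | smul r w =>
    rw [smul_mul_assoc, map_smul, map_smul, X, ← ofWord_mul, lastEval_ofWord, lastEval_ofWord,
      FreeMonoid.toList_mul, FreeMonoid.toList_of, List.reverse_append, List.reverse_singleton,
      List.singleton_append, lastSum, Rat.smul_def, Rat.smul_def]
    ring

theorem lastEval_mul_Y (n : ℕ) (a : H) : lastEval n (a * Y) = 1 / (n : ℝ) * truncEval n a := by
  induction a using hoffman_induction with
  | zero => simp
  | add a b ha hb => rw [add_mul, map_add, map_add, ha, hb, mul_add]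
  | smul r w =>
    rw [smul_mul_assoc, map_smul, map_smul, Y, ← ofWord_mul, lastEval_ofWord, truncEval_ofWord,
      FreeMonoid.toList_mul, FreeMonoid.toList_of, List.reverse_append, List.reverse_singleton,
      List.singleton_append, lastSum, Rat.smul_def, Rat.smul_def, truncSum]
    ring

theorem lastEval_mul_X_pow (n m : ℕ) (a : H) :
    lastEval n (a * X ^ m) = (1 / (n : ℝ)) ^ m * lastEval n a := by
  induction m with
  | zero => simp
  | succ m ih => rw [pow_succ, ← mul_assoc, lastEval_mul_X, ih, pow_succ]; ring

/-- The factor is the same as for x^m, but the truncated sum replaces the last term. The x^m and y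
x^{m-1} contributions thus add up to a multiple of `truncEval (n + 1) a`, which is how the two
even-odd sums in 𝔇 combine. -/
theorem lastEval_mul_Y_mul_X_pow (n : ℕ) {m : ℕ} (hm : 1 ≤ m) (a : H) :
    lastEval n (a * Y * X ^ (m - 1)) = (1 / (n : ℝ)) ^ m * truncEval n a := by
  rw [lastEval_mul_X_pow, lastEval_mul_Y, ← mul_assoc, ← pow_succ, Nat.sub_add_cancel hm]

theorem truncEval_one_mul_X (a : H) : truncEval 1 (a * X) = 0 := by
  induction a using hoffman_induction with
  | zero => simp
  | add a b ha hb => rw [add_mul, map_add, ha, hb, add_zero]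
  | smul r w =>
    rw [smul_mul_assoc, map_smul, X, ← ofWord_mul, truncEval_ofWord, FreeMonoid.toList_mul,
      FreeMonoid.toList_of, List.reverse_append, List.reverse_singleton, List.singleton_append,
      truncSum, Finset.sum_range_one, lastSum_zero_of_cons, smul_zero]

theorem truncEval_one (N : ℕ) : truncEval (N + 1) 1 = 1 := by
  rw [← ofWord_one, truncEval_ofWord, truncSum, Finset.sum_range_succ']
  simp [lastSum]

/-- Only n = 0 is summed, and it sees only the empty word, whereas every term of the recursion ends
in x. -/
theorem truncEval_one_frakD {c : List ℕ} (hc : c ≠ []) : truncEval 1 (frakD c) = 0 := by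
  have h1 : ∀ (a : H) {m : ℕ}, 1 ≤ m → truncEval 1 (a * X ^ m) = 0 := by
    intro a m hm
    rw [← Nat.sub_add_cancel hm, pow_succ, ← mul_assoc, truncEval_one_mul_X]
  rw [frakD, if_neg hc, map_add, map_add, map_sum, map_sum, map_sum]
  simp only [map_sum]
  rw [Finset.sum_eq_zero, Finset.sum_eq_zero, Finset.sum_eq_zero]
  · simp
  all_goals
    refine fun A _ => Finset.sum_eq_zero fun B _ => ?_
    split_ifs with h
    · rw [map_smul, h1 _ (by omega), smul_zero]
    · exact map_zero _

/-- The boundary pairs {0, 1} and {2s, 2s+1} each have one member outside the positions. They keep 1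
and 2s out of A, as `EvenOdd` does, and impose nothing on B. -/
theorem pairCompatible_zero_iff {c A B} {s : ℕ} (hc : (c : List ℕ).length = 2 * s)
    (hA : A ⊆ onePos c) (hB : B ⊆ bigPos c) :
    PairCompatible 0 A B ↔ EvenOdd A ∧ NoEvenOddPair s B := by
  have hA' := fun i hi => mem_positions_of_subset_onePos hA (i := i) hi
  have hB' := fun i hi => mem_positions_of_subset_bigPos hB (i := i) hi
  constructor
  · intro h
    refine ⟨fun i hi => ⟨fun he => ?_, fun ho => ?_⟩, fun r _ hr => ?_⟩
    · exact (h i (Nat.even_iff.1 he)).1.1 hi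
    · have := hA' i hi
      refine (h (i - 1) (by have := Nat.odd_iff.1 ho; omega)).1.2 ?_
      rwa [Nat.sub_add_cancel this.1]
    · rw [Finset.insert_subset_iff, Finset.singleton_subset_iff] at hr
      exact (h (2 * r) (by omega)).2 hr
  · rintro ⟨h1, h2⟩ i hi
    refine ⟨⟨fun hA => (h1 i hA).1 (Nat.even_iff.2 hi), fun hA => ?_⟩, fun hB => ?_⟩
    · simpa using (h1 (i + 1) hA).2 (Nat.odd_iff.2 (by omega))
    · have b1 := hB' _ hB.1
      have b2 := hB' _ hB.2
      refine h2 (i / 2) (Finset.mem_Icc.2 (by omega)) ?_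
      rw [Finset.insert_subset_iff, Finset.singleton_subset_iff,
        show 2 * (i / 2) = i by omega]
      exact hB

theorem pairCompatible_one_iff {c A B} {s : ℕ} (hc : (c : List ℕ).length = 2 * s)
    (hA : A ⊆ onePos c) (hB : B ⊆ bigPos c) :
    PairCompatible 1 A B ↔ OddEven A ∧ NoOddEvenPair s B := by
  have hA' := fun i hi => mem_positions_of_subset_onePos hA (i := i) hi
  have hB' := fun i hi => mem_positions_of_subset_bigPos hB (i := i) hi
  constructor
  · intro h
    refine ⟨fun i hi => ⟨fun he => ?_, fun ho => ?_⟩, fun r hr' hr => ?_⟩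
    · exact (h i (Nat.odd_iff.1 he)).1.1 hi
    · have := hA' i hi
      refine (h (i - 1) (by have := Nat.even_iff.1 ho; omega)).1.2 ?_
      rwa [Nat.sub_add_cancel this.1]
    · rw [Finset.insert_subset_iff, Finset.singleton_subset_iff] at hr
      have := Finset.mem_Icc.1 hr'
      refine (h (2 * r - 1) (by omega)).2 ⟨hr.1, ?_⟩
      rw [show 2 * r - 1 + 1 = 2 * r by omega]
      exact hr.2
  · rintro ⟨h1, h2⟩ i hi
    refine ⟨⟨fun hA => (h1 i hA).1 (Nat.odd_iff.2 hi), fun hA => ?_⟩, fun hB => ?_⟩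
    · simpa using (h1 (i + 1) hA).2 (Nat.even_iff.2 (by omega))
    · have b1 := hB' _ hB.1
      have b2 := hB' _ hB.2
      refine h2 ((i + 1) / 2) (Finset.mem_Icc.2 (by omega)) ?_
      rw [Finset.insert_subset_iff, Finset.singleton_subset_iff,
        show 2 * ((i + 1) / 2) - 1 = i by omega, show 2 * ((i + 1) / 2) = i + 1 by omega]
      exact hB

/-- Ensures that the reduced tuple again has even length, so that the induction on the weight
applies to it. -/
theorem PairCompatible.even_card {e : ℕ} {A B : Finset ℕ} (h : PairCompatible e A B) (he : e < 2)
    (h0 : 0 ∉ A) : Even A.card := by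
  have h1 := Finset.card_filter_add_card_filter_not (s := A) (fun i => i % 2 = e)
  have h2 : A.filter (fun i => ¬i % 2 = e) = (A.filter fun i => i % 2 = e).image (· + 1) := by
    ext j
    simp only [Finset.mem_filter, Finset.mem_image]
    constructor
    · rintro ⟨hj, hje⟩
      obtain ⟨i, rfl⟩ : ∃ i, j = i + 1 := by
        refine ⟨j - 1, ?_⟩
        rcases j with _ | j
        · exact absurd hj h0
        · rfl
      have hi : i % 2 = e := by omega
      exact ⟨i, ⟨(h i hi).1.2 hj, hi⟩, rfl⟩
    · rintro ⟨i, ⟨hi, hie⟩, rfl⟩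
      exact ⟨(h i hie).1.1 hi, by omega⟩
  rw [h2, Finset.card_image_of_injective _ (add_left_injective 1)] at h1
  exact ⟨_, h1.symm⟩

theorem length_reduce_add {c : List ℕ} {A : Finset ℕ} (B : Finset ℕ) (hA : A ⊆ onePos c) :
    (reduce c A B).length + A.card = c.length := by
  rw [reduce, List.length_map]
  have h1 := List.length_eq_length_filter_add (l := List.range' 1 c.length)
    (fun i => decide (i ∈ A))
  have h2 : A.card = ((List.range' 1 c.length).filter fun i => decide (i ∈ A)).length := by
    rw [← List.toFinset_card_of_nodup (List.Nodup.filter _ List.nodup_range')]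
    congr 1
    ext i
    simp only [List.mem_toFinset, List.mem_filter, List.mem_range'_1, decide_eq_true_eq]
    refine ⟨fun hi => ⟨?_, hi⟩, fun hi => hi.2⟩
    have := mem_positions_of_subset_onePos hA hi
    omega
  rw [List.length_range'] at h1
  rw [h2]
  simp only [decide_not]
  omega

theorem reduce_empty (c : List ℕ) : reduce c ∅ ∅ = c := by
  induction c using List.reverseRecOn with
  | nil => rfl
  | append_singleton t a ih => simp [reduce_append, ih]

/-- The terms with #A + #B = 1 are the same for both parities; this explains why 𝔇 has them only in
its first sum. -/
theorem pairCompatible_of_card_eq_one {e : ℕ} (he : e < 2) {A B : Finset ℕ} (h0 : 0 ∉ A)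
    (h : A.card + B.card = 1) : PairCompatible e A B ↔ A = ∅ := by
  constructor
  · intro hg
    have := hg.even_card he h0
    rw [← Finset.card_eq_zero]
    obtain ⟨k, hk⟩ := this
    omega
  · rintro rfl
    rw [Finset.card_empty, zero_add, Finset.card_eq_one] at h
    obtain ⟨b, rfl⟩ := h
    intro i _
    simp only [Finset.notMem_empty, Finset.mem_singleton, true_and]
    omega

theorem sum_filter_filter_eq_compat {c : List ℕ} {e k : ℕ} (P : Finset ℕ → Prop)
    (Q : Finset ℕ → Prop) [DecidablePred P]
    [∀ A : Finset ℕ, DecidablePred fun B : Finset ℕ => k ≤ A.card + B.card ∧ Q B]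
    (hPQ : ∀ A B, A ⊆ onePos c → B ⊆ bigPos c → (PairCompatible e A B ↔ P A ∧ Q B))
    (f : Finset ℕ → Finset ℕ → ℝ) :
    (∑ A ∈ (onePos c).powerset with P A,
      ∑ B ∈ (bigPos c).powerset with k ≤ A.card + B.card ∧ Q B, f A B) =
      ∑ A ∈ (onePos c).powerset, ∑ B ∈ (bigPos c).powerset,
        compat e A B * if k ≤ A.card + B.card then f A B else 0 := by
  rw [Finset.sum_filter]
  refine Finset.sum_congr rfl fun A hA => ?_
  rw [Finset.mem_powerset] at hA
  split_ifs with hP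
  · rw [Finset.sum_filter]
    refine Finset.sum_congr rfl fun B hB => ?_
    rw [Finset.mem_powerset] at hB
    have := hPQ A B hA hB
    by_cases hQ : Q B
    · rw [compat, if_pos (this.2 ⟨hP, hQ⟩), one_mul]
      simp [hQ]
    · rw [compat, if_neg fun h => hQ (this.1 h).2, zero_mul]
      simp [hQ]
  · refine (Finset.sum_eq_zero fun B hB => ?_).symm
    rw [Finset.mem_powerset] at hB
    rw [compat, if_neg fun h => hP ((hPQ A B hA hB).1 h).1, zero_mul]

theorem neg_one_zpow_sub_one_smul (n : ℕ) (r : ℝ) :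
    (-1 : ℚ) ^ ((n : ℤ) - 1) • r = -((-1 : ℝ) ^ n * r) := by
  rw [Rat.smul_def, zpow_sub₀ (by norm_num), zpow_natCast]
  push_cast
  ring

theorem neg_one_pow_smul (n : ℕ) (r : ℝ) : (-1 : ℚ) ^ n • r = (-1 : ℝ) ^ n * r := by
  rw [Rat.smul_def]
  push_cast
  rfl

open Classical in
/-- The truncated evaluation of `𝔇(c)` is the discretised iterated integral of `c`. -/
theorem truncEval_frakD (n : ℕ) : ∀ (c : List ℕ) (s : ℕ), c.sum = n → c.length = 2 * s → ∀ M,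
    truncEval (M + 1) (frakD c) = blockSum (M + 1) c.reverse M := by
  induction n using Nat.strong_induction_on with
  | _ n ih =>
  intro c s hn hc M
  rcases eq_or_ne c [] with rfl | hne
  · rw [frakD_nil, truncEval_one, List.reverse_nil, blockSum_nil]
  have hs : 0 < s := by
    have := List.length_pos_iff.2 hne
    omega
  induction M with
  | zero =>
    rw [truncEval_one_frakD hne]
    obtain ⟨a, t, ht⟩ := List.exists_cons_of_ne_nil (List.reverse_ne_nil_iff.2 hne)
    rw [ht, blockSum_cons_zero]
  | succ M ihM =>
    rw [truncEval_succ, ihM]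
    set q : ℝ := 1 / ((M + 1 : ℕ) : ℝ) with hq
    have hqM : q * (M + 1) = 1 := by
      rw [hq]
      push_cast
      field_simp
    have hrec := pairSum_blockSum hqM hs hc
    have h0 : ∀ A, A ⊆ onePos c → 0 ∉ A := fun A hA h => by
      have := mem_positions_of_subset_onePos hA h
      omega
    -- Stated for every level, since the reduced tuples are needed at the levels M+1 and M+2.
    have ih' : ∀ e A B, e < 2 → A ⊆ onePos c → B ⊆ bigPos c → 1 ≤ A.card + B.card →
        PairCompatible e A B → ∀ K, truncEval (K + 1) (frakD (reduce c A B)) =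
          blockSum (K + 1) (reduce c A B).reverse K := by
      intro e A B he hA hB hm hg
      have h1 := reduce_sum_add hA hB
      have h2 := length_reduce_add B hA
      obtain ⟨k, hk⟩ := hg.even_card he (h0 A hA)
      exact ih _ (by omega) _ (s - k) rfl (by omega)
    rw [← sub_eq_zero] at hrec
    -- Adding the difference of the two sides of the recurrence, which is zero, cancels every term
    -- of the recursion for 𝔇 and leaves only A = B = ∅.
    have key : lastEval (M + 1) (frakD c) +
        (pairSum q 0 c (fun l => blockSum (M + 2) l.reverse (M + 1)) -
          pairSum q 1 c fun l => blockSum (M + 1) l.reverse M) =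
        blockSum (M + 2) c.reverse (M + 1) - blockSum (M + 1) c.reverse M := by
      rw [frakD_rec s c hs hc, map_add, map_add]
      simp only [map_sum, map_smul]
      rw [sum_filter_filter_eq_compat (e := 0) (k := 1) EvenOdd (NoEvenOddPair s)
          (fun A B hA hB => pairCompatible_zero_iff hc hA hB),
        sum_filter_filter_eq_compat (e := 0) (k := 2) EvenOdd (NoEvenOddPair s)
          (fun A B hA hB => pairCompatible_zero_iff hc hA hB),
        sum_filter_filter_eq_compat (e := 1) (k := 2) OddEven (NoOddEvenPair s)
          (fun A B hA hB => pairCompatible_one_iff hc hA hB)]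
      simp only [pairSum, ← Finset.sum_add_distrib, ← Finset.sum_sub_distrib]
      have term : ∀ A ∈ (onePos c).powerset, ∀ B ∈ (bigPos c).powerset,
          compat 0 A B * (if 1 ≤ A.card + B.card then
              (-1 : ℚ) ^ ((B.card : ℤ) - 1) •
                lastEval (M + 1) (frakD (reduce c A B) * X ^ (A.card + B.card)) else 0) +
            compat 0 A B * (if 2 ≤ A.card + B.card then
              (-1 : ℚ) ^ ((B.card : ℤ) - 1) • lastEval (M + 1)
                (frakD (reduce c A B) * Y * X ^ (A.card + B.card - 1)) else 0) +
            compat 1 A B * (if 2 ≤ A.card + B.card then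
              (-1 : ℚ) ^ B.card • lastEval (M + 1)
                (frakD (reduce c A B) * Y * X ^ (A.card + B.card - 1)) else 0) +
            (compat 0 A B * ((-1) ^ B.card * q ^ (A.card + B.card) *
                blockSum (M + 2) (reduce c A B).reverse (M + 1)) -
              compat 1 A B * ((-1) ^ B.card * q ^ (A.card + B.card) *
                blockSum (M + 1) (reduce c A B).reverse M)) =
          if A = ∅ then if B = ∅ then
            blockSum (M + 2) c.reverse (M + 1) - blockSum (M + 1) c.reverse M else 0 else 0 := by
        intro A hA B hB
        rw [Finset.mem_powerset] at hA hB
        have c0 : ∀ e, ¬PairCompatible e A B → compat e A B = 0 := fun e h => if_neg h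
        have c1 : ∀ e, PairCompatible e A B → compat e A B = 1 := fun e h => if_pos h
        rcases Nat.eq_zero_or_pos (A.card + B.card) with hm | hm
        · obtain ⟨hA0, hB0⟩ := Nat.add_eq_zero_iff.1 hm
          rw [Finset.card_eq_zero] at hA0 hB0
          subst hA0 hB0
          have hp : ∀ e, PairCompatible e ∅ ∅ := fun e i _ => by simp
          rw [reduce_empty, c1 0 (hp 0), c1 1 (hp 1)]
          simp
        · have hne' : ¬(A = ∅ ∧ B = ∅) := by
            rintro ⟨rfl, rfl⟩
            simp at hm
          have hz : (if A = ∅ then if B = ∅ then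
              blockSum (M + 2) c.reverse (M + 1) - blockSum (M + 1) c.reverse M else 0 else 0) =
              (0 : ℝ) := by
            split_ifs with ha hb
            · exact absurd ⟨ha, hb⟩ hne'
            · rfl
            · rfl
          rw [hz, if_pos (show 1 ≤ A.card + B.card from hm),
            neg_one_zpow_sub_one_smul, neg_one_zpow_sub_one_smul,
            neg_one_pow_smul, lastEval_mul_X_pow, lastEval_mul_Y_mul_X_pow _ hm, ← hq]
          have hl : ∀ e, e < 2 → PairCompatible e A B →
              truncEval (M + 1) (frakD (reduce c A B)) =
                blockSum (M + 1) (reduce c A B).reverse M ∧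
              lastEval (M + 1) (frakD (reduce c A B)) =
                blockSum (M + 2) (reduce c A B).reverse (M + 1) -
                  blockSum (M + 1) (reduce c A B).reverse M := by
            intro e he hg
            have e1 := ih' e A B he hA hB hm hg M
            have e2 := ih' e A B he hA hB hm hg (M + 1)
            rw [truncEval_succ, e1] at e2
            exact ⟨e1, by linarith⟩
          -- For #A + #B ≥ 2 the even-odd terms give values at level M+2 and the odd-even ones
          -- values at M+1. For #A + #B = 1 both parities contribute, and the difference of the two
          -- levels is the single x-term.
          by_cases hm2 : 2 ≤ A.card + B.card
          · rw [if_pos hm2, if_pos hm2]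
            by_cases g0 : PairCompatible 0 A B <;> by_cases g1 : PairCompatible 1 A B
            · rw [c1 0 g0, c1 1 g1, (hl 0 (by norm_num) g0).1, (hl 0 (by norm_num) g0).2]
              ring
            · rw [c1 0 g0, c0 1 g1, (hl 0 (by norm_num) g0).1, (hl 0 (by norm_num) g0).2]
              ring
            · rw [c0 0 g0, c1 1 g1, (hl 1 (by norm_num) g1).1]
              ring
            · rw [c0 0 g0, c0 1 g1]
              ring
          · rw [if_neg hm2, if_neg hm2]
            have hm1 : A.card + B.card = 1 := by omega
            have hg := fun e he => pairCompatible_of_card_eq_one (e := e) he (h0 A hA) hm1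
            by_cases ha : A = ∅
            · have g0 := (hg 0 (by norm_num)).2 ha
              rw [c1 0 g0, c1 1 ((hg 1 (by norm_num)).2 ha), (hl 0 (by norm_num) g0).2]
              ring
            · rw [c0 0 fun h => ha ((hg 0 (by norm_num)).1 h),
                c0 1 fun h => ha ((hg 1 (by norm_num)).1 h)]
              ring
      rw [Finset.sum_congr rfl fun A hA => Finset.sum_congr rfl (term A hA)]
      simp
    rw [hrec, add_zero] at key
    rw [key]
    ring


/-! ### Block words, and the limit of the finite identity. -/

theorem eWord_append (k l : List ℕ) : eWord (k ++ l) = eWord k * eWord l := by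
  rw [eWord, List.map_append, List.prod_append]
  rfl

theorem eWord_singleton (a : ℕ) :
    eWord [a] = FreeMonoid.of Letter.y * FreeMonoid.of Letter.x ^ (a - 1) := by
  simp [eWord]

theorem eWord_replicate_one (m : ℕ) : eWord (List.replicate m 1) = FreeMonoid.of Letter.y ^ m := by
  simp [eWord]

theorem eWord_blockIndex : ∀ (s : ℕ) (c : List ℕ), c.length = 2 * s → (∀ a ∈ c, 0 < a) →
    eWord (blockIndex c) = blockWord c
  | _, [], _, _ => rfl
  | _, [_], h, _ => by simp at h; omega
  | s, a :: b :: t, h, hc => by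
    have ht := eWord_blockIndex (s - 1) t (by simp at h; omega) fun d hd => hc d (by simp [hd])
    obtain ⟨a, rfl⟩ : ∃ a', a = a' + 1 := ⟨a - 1, by have := hc a (by simp); omega⟩
    rw [blockIndex, blockWord, eWord_append, ← List.singleton_append, eWord_append,
      eWord_replicate_one, eWord_singleton, ht, Nat.add_sub_cancel, Nat.add_sub_cancel, pow_succ]
    simp only [mul_assoc]

theorem IsAdmissible.append {k : List ℕ} (hk : IsAdmissible k) {u : List ℕ}
    (hu : ∀ a ∈ u, 0 < a) : IsAdmissible (u ++ k) := by
  obtain ⟨h, t, a, ha, rfl⟩ := hk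
  refine ⟨fun b hb => ?_, u ++ t, a, ha, by simp⟩
  rcases List.mem_append.1 hb with hb | hb
  · exact hu b hb
  · exact h b hb

theorem isAdmissible_singleton {a : ℕ} (ha : 2 ≤ a) : IsAdmissible [a] :=
  ⟨by simp; omega, [], a, ha, rfl⟩

theorem isAdmissible_blockIndex : ∀ (s : ℕ) (c : List ℕ), 0 < s → c.length = 2 * s →
    (∀ a ∈ c, 0 < a) → IsAdmissible (blockIndex c)
  | s, [], hs, h, _ => by simp at h; omega
  | _, [_], _, h, _ => by simp at h; omega
  | s, [a, b], _, _, hc => by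
    have hb := hc b (by simp)
    exact (isAdmissible_singleton (by omega)).append fun d hd => by
      rw [List.eq_of_mem_replicate hd]; norm_num
  | s, a :: b :: d :: t, _, h, hc => by
    have ht := isAdmissible_blockIndex (s - 1) (d :: t) (by simp at h; omega)
      (by simp at h ⊢; omega) fun e he => hc e (by simp at he ⊢; tauto)
    rw [blockIndex, ← List.singleton_append, ← List.append_assoc]
    refine ht.append fun e he => ?_
    rcases List.mem_append.1 he with he | he
    · rw [List.eq_of_mem_replicate he]
      norm_num
    · rw [List.mem_singleton.1 he]
      omega

theorem revBlockWord_append (l : List ℕ) (a b : ℕ) : revBlockWord (l ++ [b, a]) =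
    revBlockWord l ++ (List.replicate b Letter.x ++ List.replicate a Letter.y) := by
  induction l with
  | nil => simp [revBlockWord, blockLetter]
  | cons d l ih =>
    rw [List.cons_append, revBlockWord, ih, revBlockWord, List.append_assoc]
    congr 2
    simp only [blockLetter, List.length_append, List.length_cons, List.length_nil]
    congr 1
    rw [eq_iff_iff]
    omega

theorem revBlockWord_reverse : ∀ (s : ℕ) (c : List ℕ), c.length = 2 * s →
    revBlockWord c.reverse = (blockWord c).toList.reverse
  | _, [], _ => rfl
  | _, [_], h => by simp at h; omega
  | s, a :: b :: t, h => by
    have ht := revBlockWord_reverse (s - 1) t (by simp at h; omega)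
    rw [List.reverse_cons, List.reverse_cons, List.append_assoc, List.singleton_append,
      revBlockWord_append, ht, blockWord]
    simp [FreeMonoid.toList_mul, toList_of_pow]

theorem tendsto_truncEval_frakD {s : ℕ} {c : List ℕ} (hs : 0 < s) (hlen : c.length = 2 * s)
    (hpos : ∀ a ∈ c, 0 < a) :
    Tendsto (fun M => truncEval (M + 1) (frakD c)) atTop (𝓝 (mzv (blockIndex c))) := by
  have hadm := isAdmissible_blockIndex s c hs hlen hpos
  have h1 := tendsto_truncSum_eWord hadm
  obtain ⟨w, hw⟩ := hadm.reverse_eWord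
  have hlast : (Letter.x :: w).getLast? ≠ some Letter.x := by
    rw [← hw, eWord_blockIndex s c hlen hpos, List.getLast?_reverse]
    rcases blockWord_eq s c hlen hpos with rfl | ⟨v, hv⟩
    · simp at hlen
      omega
    · rw [hv]
      simp [FreeMonoid.toList_mul]
  rw [hw] at h1
  have h2 := (tendsto_weakSum_sub_truncSum w hlast).add h1
  rw [zero_add] at h2
  refine h2.congr fun M => ?_
  rw [sub_add_cancel, truncEval_frakD _ c s rfl hlen M, blockSum,
    if_neg fun h => (hpos 0 (List.mem_reverse.1 h)).ne' rfl, revBlockWord_reverse s c hlen,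
    ← eWord_blockIndex s c hlen hpos, hw]

/-! ### Integrality, weight and the expansion in the words e_l. -/

/-- The additive group generated by the words `e_{l₁} ⋯ e_{l_m}` of weight `n` with `m ≥ 1` and all
`l_i ≥ 2`. -/
noncomputable def hoffmanSpan (n : ℕ) : AddSubgroup H := AddSubgroup.closure
  {a | ∃ l : List ℕ, l ≠ [] ∧ (∀ b ∈ l, 2 ≤ b) ∧ l.sum = n ∧ a = ofWord (eWord l)}

theorem ofWord_eWord_mem_hoffmanSpan {l : List ℕ} {n : ℕ} (h1 : l ≠ []) (h2 : ∀ b ∈ l, 2 ≤ b)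
    (h3 : l.sum = n) : ofWord (eWord l) ∈ hoffmanSpan n :=
  AddSubgroup.subset_closure ⟨l, h1, h2, h3, rfl⟩

theorem ofWord_eWord_mul (l : List ℕ) (m : ℕ) :
    ofWord (eWord l) * Y * X ^ (m - 1) = ofWord (eWord (l ++ [m])) := by
  have : X ^ (m - 1) = ofWord (FreeMonoid.of Letter.x ^ (m - 1)) :=
    (map_pow (MonoidAlgebra.of ℚ Word) _ _).symm
  rw [eWord_append, eWord_singleton, this, Y, ← ofWord_mul, ← ofWord_mul, mul_assoc]

theorem mul_X_mem_hoffmanSpan {a : H} {n : ℕ} (ha : a ∈ hoffmanSpan n) :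
    a * X ∈ hoffmanSpan (n + 1) := by
  induction ha using AddSubgroup.closure_induction with
  | mem a ha =>
    obtain ⟨l, h1, h2, h3, rfl⟩ := ha
    rcases l.eq_nil_or_concat' with rfl | ⟨t, b, rfl⟩
    · exact absurd rfl h1
    · have hb := h2 b (by simp)
      rw [← ofWord_eWord_mul, mul_assoc _ _ X, ← pow_succ, show b - 1 + 1 = b + 1 - 1 by omega,
        ofWord_eWord_mul]
      refine ofWord_eWord_mem_hoffmanSpan (by simp) (fun d hd => ?_) (by simp at h3 ⊢; omega)
      rcases List.mem_append.1 hd with hd | hd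
      · exact h2 d (by simp [hd])
      · rw [List.mem_singleton.1 hd]
        omega
  | zero => rw [zero_mul]; exact zero_mem _
  | add a b _ _ ha hb => rw [add_mul]; exact add_mem ha hb
  | neg a _ ha => rw [neg_mul]; exact neg_mem ha

theorem mul_X_pow_mem_hoffmanSpan {a : H} {n : ℕ} (ha : a ∈ hoffmanSpan n) (m : ℕ) :
    a * X ^ m ∈ hoffmanSpan (n + m) := by
  induction m with
  | zero => simpa using ha
  | succ m ih =>
    rw [pow_succ, ← mul_assoc]
    exact mul_X_mem_hoffmanSpan ih

theorem mul_Y_mul_X_pow_mem_hoffmanSpan {a : H} {n : ℕ} (ha : a ∈ hoffmanSpan n) {m : ℕ}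
    (hm : 2 ≤ m) : a * Y * X ^ (m - 1) ∈ hoffmanSpan (n + m) := by
  induction ha using AddSubgroup.closure_induction with
  | mem a ha =>
    obtain ⟨l, h1, h2, h3, rfl⟩ := ha
    rw [ofWord_eWord_mul]
    refine ofWord_eWord_mem_hoffmanSpan (by simp) (fun d hd => ?_) (by simp at h3 ⊢; omega)
    rcases List.mem_append.1 hd with hd | hd
    · exact h2 d (by simp [hd])
    · rw [List.mem_singleton.1 hd]
      omega
  | zero => rw [zero_mul, zero_mul]; exact zero_mem _
  | add a b _ _ ha hb => rw [add_mul, add_mul]; exact add_mem ha hb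
  | neg a _ ha => rw [neg_mul, neg_mul]; exact neg_mem ha

theorem neg_one_zpow_smul_mem {n : ℕ} {a : H} (k : ℤ) (ha : a ∈ hoffmanSpan n) :
    (-1 : ℚ) ^ k • a ∈ hoffmanSpan n := by
  rcases Int.even_or_odd k with h | h
  · rwa [h.neg_one_zpow, one_smul]
  · rw [h.neg_one_zpow, neg_smul, one_smul]
    exact neg_mem ha

/-- An even-odd A cannot contain 1, because 0 is not a position; so the first entry survives. Thus
multiplication by a power of x is never applied to 𝔇(∅) = 1, which would leave the span. -/
theorem reduce_ne_nil {c : List ℕ} (hc : c ≠ []) {A : Finset ℕ} (hA : A ⊆ onePos c)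
    (he : EvenOdd A) (B : Finset ℕ) : reduce c A B ≠ [] := by
  intro h
  have h1 : 1 ∉ A := fun h1 => by
    have := mem_positions_of_subset_onePos hA ((he 1 h1).2 odd_one)
    omega
  have h2 : 1 ∈ (List.range' 1 c.length).filter (· ∉ A) := by
    have := List.length_pos_iff.2 hc
    simp only [List.mem_filter, List.mem_range'_1, decide_eq_true_eq]
    exact ⟨by omega, h1⟩
  rw [reduce, List.map_eq_nil_iff] at h
  rw [h] at h2
  simp at h2

theorem frakD_mem_hoffmanSpan (n : ℕ) : ∀ c : List ℕ, c.sum = n → c ≠ [] →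
    frakD c ∈ hoffmanSpan n := by
  induction n using Nat.strong_induction_on with
  | _ n ih =>
  intro c hn hc
  rw [frakD, if_neg hc]
  refine add_mem (add_mem ?_ ?_) ?_ <;>
    refine sum_mem fun A _ => sum_mem fun B _ => ?_ <;> split_ifs with h <;>
    try exact zero_mem _
  all_goals
    obtain ⟨hA, hB, he, hm, -⟩ := h
    have hsum := reduce_sum_add hA hB
    rw [← hn, ← hsum]
  · exact neg_one_zpow_smul_mem _ (mul_X_pow_mem_hoffmanSpan
      (ih _ (by omega) _ rfl (reduce_ne_nil hc hA he B)) _)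
  · exact neg_one_zpow_smul_mem _ (mul_Y_mul_X_pow_mem_hoffmanSpan
      (ih _ (by omega) _ rfl (reduce_ne_nil hc hA he B)) hm)
  · rw [← zpow_natCast]
    refine neg_one_zpow_smul_mem _ ?_
    -- An odd-even A may delete everything. The term is then a single e_m with m ≥ 2.
    by_cases hr : reduce c A B = []
    · rw [hr, frakD_nil, ← ofWord_one]
      refine (ofWord_eWord_mul [] _) ▸ ofWord_eWord_mem_hoffmanSpan (by simp) ?_ (by simp)
      simpa using hm
    · exact mul_Y_mul_X_pow_mem_hoffmanSpan (ih _ (by omega) _ rfl hr) hm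

/-- The linear map on `ℚ⟨x, y⟩` that extends `Z`. -/
noncomputable def mzvEval : H →ₗ[ℚ] ℝ := wordLift fun w => mzv (wordIndex w.toList)

theorem isAdmissible_of_two_le {l : List ℕ} (h1 : l ≠ []) (h2 : ∀ b ∈ l, 2 ≤ b) :
    IsAdmissible l := by
  refine ⟨fun a ha => by have := h2 a ha; omega, ?_⟩
  rcases l.eq_nil_or_concat' with rfl | ⟨t, b, rfl⟩
  · exact absurd rfl h1
  · exact ⟨t, b, h2 b (by simp), rfl⟩

theorem mzvEval_eWord {l : List ℕ} (h : ∀ b ∈ l, 0 < b) : mzvEval (ofWord (eWord l)) = mzv l := by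
  rw [mzvEval, wordLift_ofWord, wordIndex_eWord l h]

theorem tendsto_truncEval {a : H} {n : ℕ} (ha : a ∈ hoffmanSpan n) :
    Tendsto (fun M => truncEval (M + 1) a) atTop (𝓝 (mzvEval a)) := by
  induction ha using AddSubgroup.closure_induction with
  | mem a ha =>
    obtain ⟨l, h1, h2, -, rfl⟩ := ha
    have hadm := isAdmissible_of_two_le h1 h2
    rw [mzvEval_eWord hadm.1]
    exact (tendsto_truncSum_eWord hadm).congr fun M => (truncEval_ofWord _ _).symm
  | zero => simp
  | add a b _ _ ha hb => simpa using ha.add hb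
  | neg a _ ha => simpa using ha.neg

theorem coeff_ofWord (v w : Word) [Decidable (v = w)] :
    (ofWord v).coeff w = if v = w then 1 else 0 := by
  rw [ofWord, MonoidAlgebra.of_apply, MonoidAlgebra.coeff_single, Finsupp.single_apply]

theorem exists_int_coeff {a : H} {n : ℕ} (ha : a ∈ hoffmanSpan n) (w : Word) :
    ∃ m : ℤ, a.coeff w = (m : ℚ) := by
  classical
  induction ha using AddSubgroup.closure_induction with
  | mem a ha =>
    obtain ⟨l, -, -, -, rfl⟩ := ha
    refine ⟨if eWord l = w then 1 else 0, ?_⟩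
    rw [coeff_ofWord]
    split_ifs <;> simp
  | zero => exact ⟨0, by simp⟩
  | add a b _ _ ha hb =>
    obtain ⟨m, hm⟩ := ha
    obtain ⟨m', hm'⟩ := hb
    exact ⟨m + m', by simp [hm, hm']⟩
  | neg a _ ha =>
    obtain ⟨m, hm⟩ := ha
    exact ⟨-m, by simp [hm]⟩

theorem eWord_injOn {k l : List ℕ} (hk : ∀ a ∈ k, 0 < a) (hl : ∀ a ∈ l, 0 < a)
    (h : eWord k = eWord l) : k = l := by
  rw [← wordIndex_eWord k hk, h, wordIndex_eWord l hl]

/-- By linearity it suffices to treat one word e_k, and by injectivity of `eWord` on positive tuples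
exactly one composition contributes there. -/
theorem mzvEval_eq_sum {a : H} {n : ℕ} (ha : a ∈ hoffmanSpan n) :
    mzvEval a = ∑ l : Composition n with ∀ b ∈ l.blocks, 2 ≤ b,
      ((a.coeff (eWord l.blocks) : ℚ) : ℝ) * mzv l.blocks := by
  classical
  induction ha using AddSubgroup.closure_induction with
  | mem a ha =>
    obtain ⟨k, h1, h2, h3, rfl⟩ := ha
    have hk : ∀ b ∈ k, 0 < b := fun b hb => by have := h2 b hb; omega
    rw [mzvEval_eWord hk, Finset.sum_eq_single ⟨k, fun {b} hb => hk b hb, h3⟩]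
    · rw [coeff_ofWord, if_pos rfl]
      simp
    · intro l _ hl
      rw [coeff_ofWord, if_neg fun h => hl ?_]
      · simp
      · exact Composition.ext (eWord_injOn hk (fun b hb => l.blocks_pos hb) h).symm
    · intro h
      exact absurd (Finset.mem_filter.2 ⟨Finset.mem_univ _, h2⟩) h
  | zero => simp
  | add a b _ _ ha hb =>
    rw [map_add, ha, hb, ← Finset.sum_add_distrib]
    refine Finset.sum_congr rfl fun l _ => ?_
    rw [MonoidAlgebra.coeff_add, Finsupp.add_apply]
    push_cast
    ring
  | neg a _ ha =>
    rw [map_neg, ha, ← Finset.sum_neg_distrib]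
    refine Finset.sum_congr rfl fun l _ => ?_
    rw [MonoidAlgebra.coeff_neg, Finsupp.neg_apply]
    push_cast
    ring

theorem mzv_blockIndex {s : ℕ} {c : List ℕ} (hs : 0 < s) (hlen : c.length = 2 * s)
    (hpos : ∀ a ∈ c, 0 < a) : mzv (blockIndex c) = mzvEval (frakD c) :=
  tendsto_nhds_unique (tendsto_truncEval_frakD hs hlen hpos)
    (tendsto_truncEval (frakD_mem_hoffmanSpan _ c rfl (by rintro rfl; simp at hlen; omega)))

theorem sum_blockIndex : ∀ (s : ℕ) (c : List ℕ), c.length = 2 * s → (∀ a ∈ c, 0 < a) →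
    (blockIndex c).sum = c.sum
  | _, [], _, _ => rfl
  | _, [_], h, _ => by simp at h; omega
  | s, a :: b :: t, h, hc => by
    have ht := sum_blockIndex (s - 1) t (by simp at h; omega) fun d hd => hc d (by simp [hd])
    have := hc a (by simp)
    simp [blockIndex, ht]
    omega

/-- The index is read from its head: a leading 1 lengthens the first y-block, and a leading a ≥ 2
opens a new pair of blocks (1, a-1). -/
theorem exists_blockIndex_eq (k : List ℕ) (hk : IsAdmissible k) : ∃ (s : ℕ) (c : List ℕ),
    0 < s ∧ c.length = 2 * s ∧ (∀ a ∈ c, 0 < a) ∧ blockIndex c = k := by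
  induction k with
  | nil =>
    obtain ⟨-, t, a, -, h⟩ := hk
    simp at h
  | cons a k ih =>
    have ha := hk.1 a (by simp)
    rcases k.eq_nil_or_concat' with rfl | hk'
    · obtain ⟨-, t, b, hb, h⟩ := hk
      have hab : a = b := by
        rcases t with _ | ⟨d, t⟩
        · simpa using h
        · simp at h
      subst hab
      refine ⟨1, [1, a - 1], by norm_num, rfl, by simp; omega, ?_⟩
      simp [blockIndex]
      omega
    · have hadm : IsAdmissible k := by
        obtain ⟨h1, t, b, hb, h⟩ := hk
        refine ⟨fun d hd => h1 d (by simp [hd]), ?_⟩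
        rcases t with _ | ⟨d, t⟩
        · obtain ⟨u, e, rfl⟩ := hk'
          simp at h
        · exact ⟨t, b, hb, by simp at h; exact h.2⟩
      obtain ⟨s, c, hs, hlen, hpos, hc⟩ := ih hadm
      rcases eq_or_ne a 1 with rfl | h1
      · rcases c with _ | ⟨d, _ | ⟨e, t⟩⟩
        · simp at hlen
          omega
        · simp at hlen
          omega
        · have hd := hpos d (by simp)
          refine ⟨s, (d + 1) :: e :: t, hs, by simpa using hlen, ?_, ?_⟩
          · intro f hf
            rcases List.mem_cons.1 hf with rfl | hf
            · omega
            · exact hpos f (by simp at hf ⊢; tauto)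
          · rw [← hc, blockIndex, blockIndex, Nat.add_sub_cancel]
            obtain ⟨d, rfl⟩ : ∃ d', d = d' + 1 := ⟨d - 1, by omega⟩
            simp [List.replicate_succ]
      · refine ⟨s + 1, 1 :: (a - 1) :: c, by omega, by simp; omega, ?_, ?_⟩
        · intro f hf
          simp only [List.mem_cons] at hf
          rcases hf with rfl | rfl | hf
          · omega
          · omega
          · exact hpos f hf
        · rw [blockIndex, hc]
          simp
          omega

end HoffmanMZV

open HoffmanMZV
theorem theorem1p6 :
    -- the series that define multiple zeta values converge
    (∀ k : List ℕ, IsAdmissible k → Summable (mzvTerm k)) ∧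
    -- `ζ({1}^{c₁-1}, c₂+1, …, {1}^{c_{2s-1}-1}, c_{2s}+1) = Z(𝔇(c₁, …, c_{2s}))`
    (∀ (s : ℕ) (c : List ℕ) (_ : 0 < s) (hlen : c.length = 2 * s) (hpos : ∀ a ∈ c, 0 < a),
      mzv (blockIndex c) =
        Z (Submodule.inclusion Hge2_le_H0
          (calD ⟨ofWord (blockWord c), ofWord_blockWord_mem hlen hpos⟩))) ∧
    -- the coefficients of `𝒟(e_k)` are integers and expand `ζ(k)` in the `ζ(l)` with all `l_i ≥ 2`
    (∀ (k : List ℕ) (hk : IsAdmissible k),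
      (∀ w : Word, ∃ m : ℤ,
        (calD ⟨ofWord (eWord k), ofWord_eWord_mem hk⟩ : H).coeff w = (m : ℚ)) ∧
      mzv k = ∑ l : Composition k.sum with ∀ a ∈ l.blocks, 2 ≤ a,
        (((calD ⟨ofWord (eWord k), ofWord_eWord_mem hk⟩ : H).coeff (eWord l.blocks) : ℚ) : ℝ) *
          mzv l.blocks) := by
  refine ⟨fun k hk => summable_mzvTerm hk, fun s c hs hlen hpos => ?_, fun k hk => ?_⟩
  · rw [mzv_blockIndex hs hlen hpos, ← calD_blockWord hlen hpos]
    rfl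
  · obtain ⟨s, c, hs, hlen, hpos, rfl⟩ := exists_blockIndex_eq k hk
    have hc : c ≠ [] := by
      rintro rfl
      simp at hlen
      omega
    have hD : (calD ⟨ofWord (eWord (blockIndex c)), ofWord_eWord_mem hk⟩ : H) = frakD c := by
      simp only [eWord_blockIndex s c hlen hpos]
      exact calD_blockWord hlen hpos
    have hmem := frakD_mem_hoffmanSpan _ c (sum_blockIndex s c hlen hpos).symm hc
    rw [hD]
    exact ⟨exists_int_coeff hmem, (mzv_blockIndex hs hlen hpos).trans (mzvEval_eq_sum hmem)⟩
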